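/- Let $n \ge 2$ and let $c : \mathbb{R}^n \to \mathbb{R}$ satisfy $c > 0$, $c, c^{-1} \in L^\infty(\mathbb{R}^n)$, $\nabla c \in (L^\infty(\mathbb{R}^n))^n$ (distributional gradient), and $\operatorname{supp}(c-1)$ compact. Let $L = -c^2 \Delta$ on $L^2(\mathbb{R}^n)$ with domain $H^2(\mathbb{R}^n)$. For $\operatorname{Im} \lambda > 0$ the operator $L - \lambda^2 : H^2(\mathbb{R}^n) \to L^2(\mathbb{R}^n)$ is boundedly invertible; set $R(\lambda) = (L - \lambda^2)^{-1}$. Let $\chi \in C_0^\infty(\mathbb{R}^n)$. Then there exists $0 < \varepsilon_0 < 1$ such that $\chi R(\lambda) \chi : L^2(\mathbb{R}^n) \to H^2(\mathbb{R}^n)$ continues analytically from $\{\operatorname{Im} \lambda > 0\}$ to $$Q_{\varepsilon_0} = \{ \lambda \in \mathbb{C} : |\operatorname{Re} \lambda| \le \varepsilon_0,\ |\operatorname{Im} \lambda| \le \varepsilon_0 \} \setminus \{ i r : r \le 0 \}$$ (that is, there is a single operator-valued function that is analytic in a neighborhood of each point of $\{\operatorname{Im} \lambda > 0\} \cup Q_{\varepsilon_0}$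 and equals $\chi R(\lambda) \chi$ for $\operatorname{Im} \lambda > 0$). Furthermore, there exists $C > 0$ such that the continuation, still denoted by $\chi R(\lambda) \chi$, satisfies $$\| \chi R(\lambda) \chi \|_{L^2 \to L^2} \le C \left( 1 + |\lambda|^{n-2} |\log \lambda| \right), \qquad \lambda \in Q_{\varepsilon_0},$$ where $\log$ is the branch on $\mathbb{C} \setminus \{ i r : r \le 0 \}$ that is real on the positive real axis. -/

import Mathlib

open MeasureTheory TemperedDistribution
open scoped ENNReal SchwartzMap LineDeriv ContDiff

noncomputable section

namespace LowEnergy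

/-- Euclidean space `ℝⁿ`. -/
abbrev Rn (n : ℕ) : Type := EuclideanSpace ℝ (Fin n)

/-- The `i`-th standard basis vector of `ℝⁿ`. -/
abbrev basisVec {n : ℕ} (i : Fin n) : Rn n := EuclideanSpace.single i (1 : ℝ)

/-- The complex Hilbert space `L²(ℝⁿ)` with respect to Lebesgue measure. -/
abbrev L2 (n : ℕ) : Type := Lp ℂ 2 (volume : Measure (Rn n))

/-- `v = ∂ᵢ u` in the sense of distributions, for `u, v ∈ L²(ℝⁿ)`. -/
def IsPartial {n : ℕ} (i : Fin n) (u v : L2 n) : Prop :=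
  ∂_{basisVec i} (u : 𝓢'(Rn n, ℂ)) = (v : 𝓢'(Rn n, ℂ))

lemma isPartial_iff {n : ℕ} (i : Fin n) (u v : L2 n) :
    IsPartial i u v ↔ ∂_{basisVec i} (Lp.toTemperedDistributionCLM ℂ volume 2 u) =
      Lp.toTemperedDistributionCLM ℂ volume 2 v := Iff.rfl

lemma IsPartial.zero {n : ℕ} (i : Fin n) : IsPartial i (0 : L2 n) 0 := by
  rw [isPartial_iff, map_zero, LineDeriv.lineDerivOp_zero]

lemma IsPartial.add {n : ℕ} {i : Fin n} {u v u' v' : L2 n} (h : IsPartial i u v)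
    (h' : IsPartial i u' v') : IsPartial i (u + u') (v + v') := by
  rw [isPartial_iff] at *
  rw [map_add, map_add, LineDeriv.lineDerivOp_add, h, h']

lemma IsPartial.smul {n : ℕ} {i : Fin n} {u v : L2 n} (a : ℂ) (h : IsPartial i u v) :
    IsPartial i (a • u) (a • v) := by
  rw [isPartial_iff] at *
  rw [map_smul, map_smul, LineDeriv.lineDerivOp_smul, h]

/-- The Hilbert space of triples `(u, (vᵢ)ᵢ, (wᵢⱼ)ᵢⱼ)` with all entries in `L²(ℝⁿ)`, with norm
`(‖u‖² + ∑ᵢ ‖vᵢ‖² + ∑ᵢⱼ ‖wᵢⱼ‖²)^{1/2}`. -/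
abbrev Jet (n : ℕ) : Type :=
  WithLp 2 (L2 n × WithLp 2 (PiLp 2 (fun _ : Fin n => L2 n) ×
    PiLp 2 (fun _ : Fin n × Fin n => L2 n)))

/-- The Sobolev space `H²(ℝⁿ)`: the functions `u ∈ L²(ℝⁿ)` all of whose distributional derivatives
of order at most two lie in `L²(ℝⁿ)`. An element is recorded together with its derivatives, as the
triple `(u, (∂ᵢ u)ᵢ, (∂ᵢ ∂ⱼ u)ᵢⱼ)`, which is determined by `u`; so the norm of this space is the
usual norm `(‖u‖² + ∑ᵢ ‖∂ᵢ u‖² + ∑ᵢⱼ ‖∂ᵢ ∂ⱼ u‖²)^{1/2}` of `H²(ℝⁿ)`. -/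
def H2 (n : ℕ) : Submodule ℂ (Jet n) where
  carrier := {U | (∀ j, IsPartial j U.fst (U.snd.fst j)) ∧
    ∀ i j, IsPartial i (U.snd.fst j) (U.snd.snd (i, j))}
  zero_mem' := ⟨fun j => IsPartial.zero j, fun i _ => IsPartial.zero i⟩
  add_mem' := fun hU hV =>
    ⟨fun j => (hU.1 j).add (hV.1 j), fun i j => (hU.2 i j).add (hV.2 i j)⟩
  smul_mem' := fun a _ hU => ⟨fun j => (hU.1 j).smul a, fun i j => (hU.2 i j).smul a⟩

/-- The inclusion `H²(ℝⁿ) → L²(ℝⁿ)`. -/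
def H2.incl (n : ℕ) : H2 n →L[ℂ] L2 n :=
  WithLp.fstL 2 ℂ (L2 n) _ ∘L (H2 n).subtypeL

/-- The second derivative `∂ᵢ ∂ⱼ : H²(ℝⁿ) → L²(ℝⁿ)`. -/
def H2.deriv₂ {n : ℕ} (i j : Fin n) : H2 n →L[ℂ] L2 n :=
  PiLp.proj 2 (fun _ : Fin n × Fin n => L2 n) (i, j) ∘L
    WithLp.sndL 2 ℂ (PiLp 2 (fun _ : Fin n => L2 n)) _ ∘L
      WithLp.sndL 2 ℂ (L2 n) _ ∘L (H2 n).subtypeL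

/-- The Laplacian `Δ = ∑ᵢ ∂ᵢ ∂ᵢ : H²(ℝⁿ) → L²(ℝⁿ)`. -/
def lapOp (n : ℕ) : H2 n →L[ℂ] L2 n := ∑ i, H2.deriv₂ i i

/-- Multiplication by an essentially bounded function, as a bounded operator on `L²(ℝⁿ)`. -/
def mulOp {n : ℕ} (φ : Rn n → ℂ) (hφ : MemLp φ ∞ volume) : L2 n →L[ℂ] L2 n :=
  (ContinuousLinearMap.mul ℂ ℂ).holderL volume ∞ 2 2 hφ.toLp

/-- The assumptions on the wavespeed `c`: measurable and positive, with `c, c⁻¹ ∈ L^∞(ℝⁿ)`, with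
distributional gradient in `L^∞`, and with `c - 1` compactly supported. All of them only depend on
`c` up to modification on a null set. -/
structure IsWavespeed {n : ℕ} (c : Rn n → ℝ) : Prop where
  pos : ∀ᵐ x, 0 < c x
  bdd : MemLp c ∞ volume
  inv_bdd : MemLp (fun x => (c x)⁻¹) ∞ volume
  grad_bdd : ∀ i : Fin n, ∃ g : Rn n → ℝ, MemLp g ∞ volume ∧
    ∀ φ : Rn n → ℝ, ContDiff ℝ ∞ φ → HasCompactSupport φ →
      ∫ x, c x * fderiv ℝ φ x (basisVec i) = - ∫ x, g x * φ x
  supp : ∃ K : Set (Rn n), IsCompact K ∧ ∀ᵐ x, x ∉ K → c x = 1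

lemma IsWavespeed.sq_bdd {n : ℕ} {c : Rn n → ℝ} (hc : IsWavespeed c) :
    MemLp (fun x => ((c x ^ 2 : ℝ) : ℂ)) ∞ volume := by
  have h : MemLp (fun x => c x * c x) ∞ volume := hc.bdd.mul hc.bdd
  simp only [sq]
  exact h.ofReal (K := ℂ)

/-- The operator `L = -c² Δ` on `L²(ℝⁿ)` with domain `H²(ℝⁿ)`. -/
def waveOp {n : ℕ} (c : Rn n → ℝ) (hc : IsWavespeed c) : H2 n →L[ℂ] L2 n :=
  -(mulOp (fun x => ((c x ^ 2 : ℝ) : ℂ)) hc.sq_bdd ∘L lapOp n)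

/-- The operator `L - lam²` on `L²(ℝⁿ)` with domain `H²(ℝⁿ)`. -/
def shiftedOp {n : ℕ} (c : Rn n → ℝ) (hc : IsWavespeed c) (lam : ℂ) : H2 n →L[ℂ] L2 n :=
  waveOp c hc - lam ^ 2 • H2.incl n

/-- The resolvent `R(lam) = (L - lam²)⁻¹ : L²(ℝⁿ) → H²(ℝⁿ)`; it is meaningful when
`L - lam² : H²(ℝⁿ) → L²(ℝⁿ)` has a bounded inverse. -/
def resolv {n : ℕ} (c : Rn n → ℝ) (hc : IsWavespeed c) (lam : ℂ) : L2 n →L[ℂ] H2 n :=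
  (shiftedOp c hc lam).inverse

/-- A function in `C₀^∞(ℝⁿ)`. -/
structure IsCutoff {n : ℕ} (χ : Rn n → ℂ) : Prop where
  smooth : ContDiff ℝ ∞ χ
  supp : HasCompactSupport χ

lemma IsCutoff.bdd {n : ℕ} {χ : Rn n → ℂ} (h : IsCutoff χ) : MemLp χ ∞ volume :=
  h.smooth.continuous.memLp_of_hasCompactSupport h.supp

/-- The cutoff resolvent `χ R(lam) χ`, with values in `L²(ℝⁿ)`. -/
def cutoffResolv {n : ℕ} (c : Rn n → ℝ) (hc : IsWavespeed c) (χ : Rn n → ℂ) (hχ : IsCutoff χ)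
    (lam : ℂ) : L2 n →L[ℂ] L2 n :=
  mulOp χ hχ.bdd ∘L H2.incl n ∘L resolv c hc lam ∘L mulOp χ hχ.bdd

/-- The set `i ℝ₋ = {i r : r ≤ 0}`. -/
def negImagAxis : Set ℂ := {z | z.re = 0 ∧ z.im ≤ 0}

/-- The slit square `{|Re z|, |Im z| ≤ ε} \ i ℝ₋`. -/
def slitSquare (ε : ℝ) : Set ℂ := {z | |z.re| ≤ ε ∧ |z.im| ≤ ε} \ negImagAxis

/-- The branch of the logarithm on `ℂ \ i ℝ₋` that is real on the positive real axis: its imaginary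
part lies in `(-π/2, 3π/2)`. -/
def slitLog (z : ℂ) : ℂ := Complex.log (-Complex.I * z) + (Real.pi / 2 : ℝ) * Complex.I

end LowEnergy

end

open LowEnergy

/-!
At low energy `L - λ² = c² (-Δ - λ² c⁻²)` is a small perturbation of the free operator: with
`V = 1 - c⁻²`, which is bounded and compactly supported, `-Δ - λ² c⁻² = (-Δ - λ²) + λ² V`. So the
cut-off resolvent is recovered from the cut-off free resolvent `R₀(λ) = (-Δ - λ²)⁻¹` by solving an
equation with a perturbation of size `|λ|² ‖ρ R₀(λ) ρ‖`, which tends to `0` with `λ`.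

* Invertibility for `Im λ > 0` (`hamOp_isInvertible`). The quadratic form of `-Δ - z w`, for a
  positive weight `w` and `z ∉ [0, ∞)`, takes values in the sector spanned by `1` and `-z`, which
  bounds `u` by `(-Δ - z w) u`; the adjoint has the same structure, so the range is dense as well as
  closed.

* The free resolvent (`exists_freeResolv_continuation`). High frequencies `|ξ| ≥ 1` contribute a
  Neumann series, analytic for `|λ| < 1`. The low-frequency part of `ρ R₀(λ) ρ` is the integral over
  `|ξ| < 1` of `(4 π² |ξ|² - λ²)⁻¹` times the rank one operator
  `f ↦ ⟨e^{2πi x·ξ} ρ, f⟩ e^{2πi x·ξ} ρ`. This operator extends to an entire function along each ray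
  (`planeWave`, built from exponentials of bounded multiplication operators), so in polar coordinates
  the integral is `∫₀¹ h(r) / (r² - μ²) dr` with `μ = λ / 2π` and `h` entire, divisible by `z^(n-1)`.
  Partial fractions and the subtraction of `h(± μ)` continue it across the real axis
  (`radialCont`): what remains is an entire function plus `h(± μ) / μ` times logarithms, and
  `h(± μ) / μ` is of size `|μ|^(n-2)`.

* Perturbation (`exists_cutoffResolv_continuation`). Let `ρ = 1` on the supports of `V` and `χ`, and
  let `B(λ)` be the continuation of `ρ R₀(λ) ρ`. For `Im λ > 0` the operator `A = ρ R(λ) χ` satisfies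
  `A = B (c⁻² χ - λ² V A)` (`cutoff_resolv_fixedPoint`), and for small `λ` off the cut this equation
  has a unique solution, analytic in `λ` and bounded by a multiple of `‖B(λ)‖`
  (`exists_analytic_fixedPoint`). Then
  `χ A` continues `χ R(λ) χ`.

Operators into `H²(ℝⁿ)` are written as `(1 - Δ)⁻¹ E` with `E` on `L²(ℝⁿ)` (`bessel`, `besselEquiv`),
so that analyticity in the norm of `L² → H²` is analyticity of `E` in the norm of `L² → L²`.
-/

noncomputable section

open MeasureTheory TemperedDistribution FourierTransform
open scoped ENNReal SchwartzMap LineDeriv ContDiff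

namespace LowEnergy

variable {n : ℕ}

/-! ### Multiplication operators -/

lemma coeFn_mulOp (φ : Rn n → ℂ) (hφ : MemLp φ ∞ volume) (u : L2 n) :
    mulOp φ hφ u =ᵐ[volume] fun x => φ x * u x := by
  have h := (ContinuousLinearMap.mul ℂ ℂ).coeFn_holder (r := 2) hφ.toLp u
  filter_upwards [h, hφ.coeFn_toLp] with x h1 h2
  change ((ContinuousLinearMap.mul ℂ ℂ).holder 2 hφ.toLp u) x = _
  rw [h1, h2]
  rfl

lemma mulOp_eq_of_ae {φ : Rn n → ℂ} (hφ : MemLp φ ∞ volume) {u v : L2 n}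
    (h : ∀ᵐ x, v x = φ x * u x) : mulOp φ hφ u = v := by
  apply Lp.ext
  filter_upwards [coeFn_mulOp φ hφ u, h] with x h1 h2
  rw [h1, h2]

lemma mulOp_comp {φ ψ θ : Rn n → ℂ} (hφ : MemLp φ ∞ volume) (hψ : MemLp ψ ∞ volume)
    (hθ : MemLp θ ∞ volume) (h : ∀ᵐ x, θ x = φ x * ψ x) :
    mulOp φ hφ ∘L mulOp ψ hψ = mulOp θ hθ := by
  ext1 u
  apply mulOp_eq_of_ae
  filter_upwards [coeFn_mulOp ψ hψ u, coeFn_mulOp θ hθ u, h] with x h1 h2 h3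
  rw [h2, ContinuousLinearMap.coe_coe, h1, h3, mul_assoc]

lemma mulOp_add {φ ψ θ : Rn n → ℂ} (hφ : MemLp φ ∞ volume) (hψ : MemLp ψ ∞ volume)
    (hθ : MemLp θ ∞ volume) (h : ∀ᵐ x, θ x = φ x + ψ x) :
    mulOp φ hφ + mulOp ψ hψ = mulOp θ hθ := by
  ext1 u
  symm
  apply mulOp_eq_of_ae
  filter_upwards [coeFn_mulOp ψ hψ u, coeFn_mulOp φ hφ u, h,
    Lp.coeFn_add (mulOp φ hφ u) (mulOp ψ hψ u)] with x h1 h2 h3 h4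
  rw [add_apply, h4, Pi.add_apply, h1, h2, h3, add_mul]

lemma mulOp_smul {φ θ : Rn n → ℂ} (a : ℂ) (hφ : MemLp φ ∞ volume)
    (hθ : MemLp θ ∞ volume) (h : ∀ᵐ x, θ x = a * φ x) :
    a • mulOp φ hφ = mulOp θ hθ := by
  ext1 u
  symm
  apply mulOp_eq_of_ae
  filter_upwards [coeFn_mulOp φ hφ u, h, Lp.coeFn_smul a (mulOp φ hφ u)] with x h2 h3 h4
  rw [smul_apply, h4, Pi.smul_apply, h2, h3, smul_eq_mul, mul_assoc]

lemma mulOp_eq_one {φ : Rn n → ℂ} (hφ : MemLp φ ∞ volume) (h : ∀ᵐ x, φ x = 1) :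
    mulOp φ hφ = 1 := by
  ext1 u
  apply mulOp_eq_of_ae
  filter_upwards [h] with x h1
  rw [h1, one_mul]
  rfl

lemma norm_mulOp_le {φ : Rn n → ℂ} (hφ : MemLp φ ∞ volume) {C : ℝ} (hC : 0 ≤ C)
    (h : ∀ᵐ x, ‖φ x‖ ≤ C) : ‖mulOp φ hφ‖ ≤ C := by
  refine ContinuousLinearMap.opNorm_le_bound _ hC fun u => ?_
  refine Lp.norm_le_mul_norm_of_ae_le_mul ?_
  filter_upwards [coeFn_mulOp φ hφ u, h] with x h1 h2
  rw [h1, norm_mul]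
  gcongr

lemma inner_mulOp_left {φ : Rn n → ℂ} (hφ : MemLp φ ∞ volume) (hr : ∀ᵐ x, (φ x).im = 0)
    (u v : L2 n) : inner ℂ (mulOp φ hφ u) v = inner ℂ u (mulOp φ hφ v) := by
  rw [L2.inner_def, L2.inner_def]
  apply integral_congr_ae
  filter_upwards [coeFn_mulOp φ hφ u, coeFn_mulOp φ hφ v, hr] with x h1 h2 h3
  have : (starRingEnd ℂ) (φ x) = φ x := Complex.conj_eq_iff_im.2 h3
  simp only [h1, h2, RCLike.inner_apply, map_mul, this]
  ring

/-- A lower bound for a real multiplier yields a lower bound for the quadratic form. -/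
lemma inner_mulOp_self_ge {φ : Rn n → ℂ} (hφ : MemLp φ ∞ volume) {δ : ℝ}
    (hr : ∀ᵐ x, (φ x).im = 0) (h : ∀ᵐ x, δ ≤ (φ x).re) (u : L2 n) :
    δ * ‖u‖ ^ 2 ≤ (inner ℂ u (mulOp φ hφ u)).re ∧ (inner ℂ u (mulOp φ hφ u)).im = 0 := by
  constructor
  · rw [← RCLike.re_eq_complex_re, ← inner_self_eq_norm_sq (𝕜 := ℂ) u, L2.inner_def, L2.inner_def,
      ← integral_re (L2.integrable_inner u u), ← integral_re (L2.integrable_inner u _),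
      ← integral_const_mul]
    refine integral_mono_ae ((L2.integrable_inner u u).re.const_mul δ)
      (L2.integrable_inner u _).re ?_
    filter_upwards [coeFn_mulOp φ hφ u, h] with x h1 h2
    have e : inner ℂ (u x) (φ x * u x) = φ x * ((‖u x‖ ^ 2 : ℝ) : ℂ) := by
      rw [RCLike.inner_apply, mul_assoc, Complex.mul_conj, Complex.normSq_eq_norm_sq]
    rw [h1, e, inner_self_eq_norm_sq_to_K]
    norm_cast
    simp only [RCLike.re_eq_complex_re, Complex.re_mul_ofReal]
    exact mul_le_mul_of_nonneg_right h2 (by positivity)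
  · have h1 := inner_mulOp_left hφ hr u u
    have h2 := inner_conj_symm (𝕜 := ℂ) (mulOp φ hφ u) u
    rw [h1] at h2
    exact Complex.conj_eq_iff_im.1 h2

/-! ### Weak derivatives and the product rule -/

lemma toTemperedDistribution_injective :
    Function.Injective (Lp.toTemperedDistributionCLM ℂ (volume : Measure (Rn n)) 2) := by
  have := Lp.ker_toTemperedDistributionCLM_eq_bot (F := ℂ) (μ := (volume : Measure (Rn n))) (p := 2)
  exact LinearMap.ker_eq_bot.1 this

lemma IsPartial.unique {i : Fin n} {u v w : L2 n} (hv : IsPartial i u v) (hw : IsPartial i u w) :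
    v = w := by
  rw [isPartial_iff] at hv hw
  exact toTemperedDistribution_injective (hv.symm.trans hw)

/-- The derivatives recorded in an element of `H²(ℝⁿ)` are determined by the underlying function. -/
lemma incl_injective : Function.Injective (H2.incl n) := by
  intro U V h
  have h0 : (U : Jet n).fst = (V : Jet n).fst := h
  have h1 : ∀ j, (U : Jet n).snd.fst j = (V : Jet n).snd.fst j := fun j =>
    (U.2.1 j).unique (h0 ▸ V.2.1 j)
  have h2 : ∀ i j, (U : Jet n).snd.snd (i, j) = (V : Jet n).snd.snd (i, j) := fun i j =>
    (U.2.2 i j).unique (h1 j ▸ V.2.2 i j)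
  ext1
  refine WithLp.ofLp_injective 2 (Prod.ext h0 (WithLp.ofLp_injective 2 (Prod.ext ?_ ?_)))
  · exact PiLp.ext h1
  · exact PiLp.ext fun ij => h2 ij.1 ij.2

lemma mulOp_toTemperedDistribution {φ : Rn n → ℂ} (h : IsCutoff φ) (u : L2 n) :
    Lp.toTemperedDistributionCLM ℂ volume 2 (mulOp φ h.bdd u) =
      smulLeftCLM ℂ φ (Lp.toTemperedDistributionCLM ℂ volume 2 u) := by
  have h1 := Lp.toTemperedDistribution_smul_eq (μ := (volume : Measure (Rn n))) (p := ∞) (q := 2)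
    (r := 2) (h.supp.hasTemperateGrowth h.smooth) h.bdd u
  rw [Lp.toTemperedDistributionCLM_apply, Lp.toTemperedDistributionCLM_apply, ← h1]
  rfl

/-- The classical partial derivative `∂ᵢ φ`. -/
def partialDeriv (i : Fin n) (φ : Rn n → ℂ) : Rn n → ℂ := fun x => fderiv ℝ φ x (basisVec i)

lemma IsCutoff.partialDeriv {φ : Rn n → ℂ} (h : IsCutoff φ) (i : Fin n) :
    IsCutoff (partialDeriv i φ) where
  smooth := (h.smooth.fderiv_right (m := ∞) (by simp)).clm_apply contDiff_const
  supp := h.supp.fderiv_apply ℝ (basisVec i)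

/-- The product rule for weak derivatives. -/
lemma IsPartial.mulOp {φ : Rn n → ℂ} (h : IsCutoff φ) {i : Fin n} {u v : L2 n}
    (huv : IsPartial i u v) : IsPartial i (mulOp φ h.bdd u)
      (mulOp φ h.bdd v + LowEnergy.mulOp (LowEnergy.partialDeriv i φ) (h.partialDeriv i).bdd u) := by
  rw [isPartial_iff] at *
  rw [map_add, mulOp_toTemperedDistribution h, mulOp_toTemperedDistribution h,
    mulOp_toTemperedDistribution (h.partialDeriv i), ← huv]
  have g1 := h.supp.hasTemperateGrowth h.smooth
  have g2 := (h.partialDeriv i).supp.hasTemperateGrowth (h.partialDeriv i).smooth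
  ext f
  simp only [lineDerivOp_apply_apply, smulLeftCLM_apply_apply,
    add_apply]
  rw [← map_add]
  congr 1
  ext x
  have hd : DifferentiableAt ℝ φ x := (h.smooth.differentiable (by simp)) x
  simp [g1, g2, SchwartzMap.smulLeftCLM_apply_apply, SchwartzMap.lineDerivOp_apply_eq_fderiv]
  have e : ⇑(SchwartzMap.smulLeftCLM ℂ φ f) = fun y => φ y * f y := by
    ext y; simp [SchwartzMap.smulLeftCLM_apply_apply g1]
  rw [e, fderiv_fun_mul hd (f.differentiableAt)]
  simp [LowEnergy.partialDeriv]
  ring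

/-- A bounded operator into `H²(ℝⁿ)`, given by its components in the space of jets. -/
def H2.lift {E : Type*} [NormedAddCommGroup E] [NormedSpace ℂ E] (u : E →L[ℂ] L2 n)
    (v : Fin n → E →L[ℂ] L2 n) (w : Fin n × Fin n → E →L[ℂ] L2 n)
    (hv : ∀ j x, IsPartial j (u x) (v j x)) (hw : ∀ i j x, IsPartial i (v j x) (w (i, j) x)) :
    E →L[ℂ] H2 n :=
  ((WithLp.prodContinuousLinearEquiv 2 ℂ _ _).symm.toContinuousLinearMap ∘L
    (u.prod ((WithLp.prodContinuousLinearEquiv 2 ℂ _ _).symm.toContinuousLinearMap ∘L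
      (((PiLp.continuousLinearEquiv 2 ℂ _).symm.toContinuousLinearMap ∘L
        ContinuousLinearMap.pi v).prod
        ((PiLp.continuousLinearEquiv 2 ℂ _).symm.toContinuousLinearMap ∘L
          ContinuousLinearMap.pi w))))).codRestrict (H2 n)
    fun x => ⟨fun j => hv j x, fun i j => hw i j x⟩

lemma H2.incl_lift {E : Type*} [NormedAddCommGroup E] [NormedSpace ℂ E] (u : E →L[ℂ] L2 n)
    (v : Fin n → E →L[ℂ] L2 n) (w : Fin n × Fin n → E →L[ℂ] L2 n)
    (hv : ∀ j x, IsPartial j (u x) (v j x)) (hw : ∀ i j x, IsPartial i (v j x) (w (i, j) x)) :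
    H2.incl n ∘L H2.lift u v w hv hw = u := rfl

/-- The first derivative `∂ⱼ : H²(ℝⁿ) → L²(ℝⁿ)`. -/
def H2.deriv₁ (j : Fin n) : H2 n →L[ℂ] L2 n :=
  PiLp.proj 2 (fun _ : Fin n => L2 n) j ∘L
    WithLp.fstL 2 ℂ (PiLp 2 (fun _ : Fin n => L2 n)) _ ∘L
      WithLp.sndL 2 ℂ (L2 n) _ ∘L (H2 n).subtypeL

lemma H2.isPartial_incl (U : H2 n) (j : Fin n) : IsPartial j (H2.incl n U) (H2.deriv₁ j U) :=
  U.2.1 j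

lemma H2.isPartial_deriv₁ (U : H2 n) (i j : Fin n) :
    IsPartial i (H2.deriv₁ j U) (H2.deriv₂ i j U) := U.2.2 i j

/-- Multiplication by a function in `C₀^∞(ℝⁿ)`, as a bounded operator on `H²(ℝⁿ)`. -/
def mulH2 {φ : Rn n → ℂ} (h : IsCutoff φ) : H2 n →L[ℂ] H2 n :=
  H2.lift (mulOp φ h.bdd ∘L H2.incl n)
    (fun j => mulOp φ h.bdd ∘L H2.deriv₁ j + mulOp _ (h.partialDeriv j).bdd ∘L H2.incl n)
    (fun ij => mulOp φ h.bdd ∘L H2.deriv₂ ij.1 ij.2 +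
        mulOp _ (h.partialDeriv ij.1).bdd ∘L H2.deriv₁ ij.2 +
      (mulOp _ (h.partialDeriv ij.2).bdd ∘L H2.deriv₁ ij.1 +
        mulOp _ ((h.partialDeriv ij.2).partialDeriv ij.1).bdd ∘L H2.incl n))
    (fun j U => (H2.isPartial_incl U j).mulOp h)
    (fun i j U => ((H2.isPartial_deriv₁ U i j).mulOp h).add
      ((H2.isPartial_incl U i).mulOp (h.partialDeriv j)))

lemma incl_comp_mulH2 {φ : Rn n → ℂ} (h : IsCutoff φ) :
    H2.incl n ∘L mulH2 h = mulOp φ h.bdd ∘L H2.incl n := H2.incl_lift _ _ _ _ _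

/-! ### The Fourier transform and the Laplacian -/

/-- The unitary Fourier transform of `L²(ℝⁿ)`, normalised with the phase `exp (-2 π i x · ξ)`. -/
abbrev FT (n : ℕ) : L2 n ≃ₗᵢ[ℂ] L2 n := Lp.fourierTransformₗᵢ (Rn n) ℂ

/-- The symbol `4 π² |ξ|²` of `-Δ`. -/
def lapSymbol (ξ : Rn n) : ℝ := 4 * Real.pi ^ 2 * ‖ξ‖ ^ 2

lemma lapSymbol_nonneg (ξ : Rn n) : 0 ≤ lapSymbol ξ := by unfold lapSymbol; positivity

lemma continuous_lapSymbol : Continuous (lapSymbol (n := n)) := by unfold lapSymbol; fun_prop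

/-- The Fourier transform of the equation `∂ⱼ u = v`, tested against Schwartz functions. -/
lemma isPartial_iff_integral {j : Fin n} {u v : L2 n} : IsPartial j u v ↔
    ∀ g : 𝓢(Rn n, ℂ), ∫ ξ, g ξ * (2 * Real.pi * Complex.I * (ξ j : ℂ) * FT n u ξ) =
      ∫ ξ, g ξ * FT n v ξ := by
  have hF : ∀ w : L2 n, 𝓕 (Lp.toTemperedDistributionCLM ℂ volume 2 w) =
      Lp.toTemperedDistributionCLM ℂ volume 2 (FT n w) := fun w =>
    Lp.fourier_toTemperedDistribution_eq w
  have hinj : ∀ S T : 𝓢'(Rn n, ℂ), S = T ↔ 𝓕 S = 𝓕 T := fun S T =>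
    ⟨fun h => h ▸ rfl, fun h => by
      rw [← fourierInv_fourier_eq (F := 𝓢'(Rn n, ℂ)) S, h, fourierInv_fourier_eq]⟩
  rw [isPartial_iff, hinj, fourier_lineDerivOp_eq, hF, hF]
  have hg : (fun ξ : Rn n => ((inner ℝ ξ (basisVec j) : ℝ) : ℂ)).HasTemperateGrowth := by fun_prop
  have key : ∀ g : 𝓢(Rn n, ℂ), ((2 * Real.pi * Complex.I) • smulLeftCLM ℂ
      (fun ξ : Rn n => ((inner ℝ ξ (basisVec j) : ℝ) : ℂ))
        (Lp.toTemperedDistributionCLM ℂ volume 2 (FT n u))) g =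
      ∫ ξ, g ξ * (2 * Real.pi * Complex.I * (ξ j : ℂ) * FT n u ξ) := by
    intro g
    change (2 * Real.pi * Complex.I) • (smulLeftCLM ℂ
      (fun ξ : Rn n => ((inner ℝ ξ (basisVec j) : ℝ) : ℂ))
        (Lp.toTemperedDistributionCLM ℂ volume 2 (FT n u)) g) = _
    rw [smulLeftCLM_apply_apply, Lp.toTemperedDistributionCLM_apply,
      Lp.toTemperedDistribution_apply, smul_eq_mul, ← integral_const_mul]
    congr 1
    ext ξ
    rw [SchwartzMap.smulLeftCLM_apply_apply hg]
    simp only [EuclideanSpace.inner_single_right, smul_eq_mul]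
    simp
    ring
  constructor
  · intro h g
    rw [← key, h, Lp.toTemperedDistributionCLM_apply, Lp.toTemperedDistribution_apply]
    simp
  · intro h
    ext g
    rw [key, h, Lp.toTemperedDistributionCLM_apply, Lp.toTemperedDistribution_apply]
    simp

lemma isPartial_iff_fourier {j : Fin n} {u v : L2 n} : IsPartial j u v ↔
    FT n v =ᵐ[volume] fun ξ => 2 * Real.pi * Complex.I * (ξ j : ℂ) * FT n u ξ := by
  rw [isPartial_iff_integral]
  constructor
  · intro h
    have hL : ∀ w : L2 n, LocallyIntegrable (FT n w : Rn n → ℂ) volume := fun w =>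
      (Lp.memLp (FT n w)).locallyIntegrable (by norm_num)
    refine ae_eq_of_integral_contDiff_smul_eq (hL v) ?_ fun g hg hgs => ?_
    · rw [← locallyIntegrableOn_univ]
      exact ((hL u).locallyIntegrableOn _).continuousOn_mul (by fun_prop) isOpen_univ.isLocallyClosed
    · have h1 : HasCompactSupport (Complex.ofRealCLM ∘ g) := hgs.comp_left rfl
      have h2 : ContDiff ℝ ∞ (Complex.ofRealCLM ∘ g) := by fun_prop
      have := h (h1.toSchwartzMap h2)
      simpa [Complex.real_smul] using this.symm
  · intro h g
    apply integral_congr_ae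
    filter_upwards [h] with ξ hξ
    rw [hξ]

/-- The Fourier multiplier `b(D) = 𝓕⁻¹ b 𝓕` on `L²(ℝⁿ)`. -/
def fmul (b : Rn n → ℂ) (hb : MemLp b ∞ volume) : L2 n →L[ℂ] L2 n :=
  (FT n).symm.toContinuousLinearEquiv.toContinuousLinearMap ∘L mulOp b hb ∘L
    (FT n).toContinuousLinearEquiv.toContinuousLinearMap

lemma FT_fmul (b : Rn n → ℂ) (hb : MemLp b ∞ volume) (u : L2 n) :
    FT n (fmul b hb u) = mulOp b hb (FT n u) := (FT n).apply_symm_apply _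

lemma coeFn_FT_fmul (b : Rn n → ℂ) (hb : MemLp b ∞ volume) (u : L2 n) :
    FT n (fmul b hb u) =ᵐ[volume] fun ξ => b ξ * FT n u ξ := by
  rw [FT_fmul]; exact coeFn_mulOp _ _ _

lemma fmul_eq_of_ae {b : Rn n → ℂ} (hb : MemLp b ∞ volume) {u v : L2 n}
    (h : ∀ᵐ ξ, FT n v ξ = b ξ * FT n u ξ) : fmul b hb u = v := by
  apply (FT n).injective
  rw [FT_fmul]
  exact mulOp_eq_of_ae hb h

lemma fmul_comp {φ ψ θ : Rn n → ℂ} (hφ : MemLp φ ∞ volume) (hψ : MemLp ψ ∞ volume)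
    (hθ : MemLp θ ∞ volume) (h : ∀ᵐ x, θ x = φ x * ψ x) :
    fmul φ hφ ∘L fmul ψ hψ = fmul θ hθ := by
  ext1 u
  apply (FT n).injective
  rw [ContinuousLinearMap.comp_apply, FT_fmul, FT_fmul, FT_fmul, ← mulOp_comp hφ hψ hθ h]
  rfl

lemma fmul_add {φ ψ θ : Rn n → ℂ} (hφ : MemLp φ ∞ volume) (hψ : MemLp ψ ∞ volume)
    (hθ : MemLp θ ∞ volume) (h : ∀ᵐ x, θ x = φ x + ψ x) :
    fmul φ hφ + fmul ψ hψ = fmul θ hθ := by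
  ext1 u
  apply (FT n).injective
  rw [add_apply, map_add, FT_fmul, FT_fmul, FT_fmul, ← mulOp_add hφ hψ hθ h]
  rfl

lemma fmul_smul {φ θ : Rn n → ℂ} (a : ℂ) (hφ : MemLp φ ∞ volume)
    (hθ : MemLp θ ∞ volume) (h : ∀ᵐ x, θ x = a * φ x) :
    a • fmul φ hφ = fmul θ hθ := by
  ext1 u
  apply (FT n).injective
  rw [smul_apply, map_smul, FT_fmul, FT_fmul, ← mulOp_smul a hφ hθ h]
  rfl

lemma norm_fmul_le {φ : Rn n → ℂ} (hφ : MemLp φ ∞ volume) {C : ℝ} (hC : 0 ≤ C)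
    (h : ∀ᵐ x, ‖φ x‖ ≤ C) : ‖fmul φ hφ‖ ≤ C := by
  refine ContinuousLinearMap.opNorm_le_bound _ hC fun u => ?_
  rw [← (FT n).norm_map, FT_fmul, ← (FT n).norm_map u]
  exact (mulOp φ hφ).le_of_opNorm_le (norm_mulOp_le hφ hC h) _

lemma memLp_top_of_continuous {b : Rn n → ℂ} (hb : Continuous b) {C : ℝ} (h : ∀ x, ‖b x‖ ≤ C) :
    MemLp b ∞ volume :=
  memLp_top_of_bound hb.aestronglyMeasurable C (.of_forall h)

lemma one_add_lapSymbol_ne_zero (ξ : Rn n) : (1 + lapSymbol ξ : ℂ) ≠ 0 := by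
  have := lapSymbol_nonneg ξ
  exact_mod_cast (by positivity : (1 + lapSymbol ξ) ≠ 0)

lemma norm_one_add_lapSymbol (ξ : Rn n) : ‖(1 + lapSymbol ξ : ℂ)‖ = 1 + lapSymbol ξ := by
  have := lapSymbol_nonneg ξ
  rw [← Complex.ofReal_one, ← Complex.ofReal_add, Complex.norm_real, Real.norm_of_nonneg]
  positivity

lemma norm_two_pi_I_mul (ξ : Rn n) (j : Fin n) :
    ‖2 * Real.pi * Complex.I * (ξ j : ℂ)‖ ^ 2 ≤ lapSymbol ξ := by
  have h : ‖ξ j‖ ≤ ‖ξ‖ := PiLp.norm_apply_le ξ j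
  have h' : |ξ j| ^ 2 ≤ ‖ξ‖ ^ 2 := by rw [← Real.norm_eq_abs]; gcongr
  simp only [norm_mul, Complex.norm_ofNat, Complex.norm_real, Complex.norm_I, Real.norm_eq_abs,
    mul_one, mul_pow, sq_abs, lapSymbol]
  rw [sq_abs] at h'
  nlinarith [sq_nonneg Real.pi]

/-- The symbol `(1 + 4 π² |ξ|²)⁻¹`. -/
def besselSymbol (ξ : Rn n) : ℂ := (1 + lapSymbol ξ : ℂ)⁻¹

lemma continuous_besselSymbol : Continuous (besselSymbol (n := n)) :=
  (continuous_const.add (Complex.continuous_ofReal.comp continuous_lapSymbol)).inv₀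
    one_add_lapSymbol_ne_zero

lemma norm_mul_besselSymbol_le {ξ : Rn n} {a : ℂ} (h : ‖a‖ ≤ 1 + lapSymbol ξ) :
    ‖a * besselSymbol ξ‖ ≤ 1 := by
  have := lapSymbol_nonneg ξ
  rw [besselSymbol, norm_mul, norm_inv, norm_one_add_lapSymbol, ← div_eq_mul_inv]
  exact div_le_one_of_le₀ h (by positivity)

lemma memLp_besselSymbol : MemLp (besselSymbol (n := n)) ∞ volume :=
  memLp_top_of_continuous continuous_besselSymbol (C := 1) fun ξ => by
    have := lapSymbol_nonneg ξ
    rw [← one_mul (besselSymbol ξ)]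
    exact norm_mul_besselSymbol_le (by simpa)

lemma memLp_deriv₁_symbol (j : Fin n) :
    MemLp (fun ξ : Rn n => 2 * Real.pi * Complex.I * (ξ j : ℂ) * besselSymbol ξ) ∞ volume :=
  memLp_top_of_continuous
    (Continuous.mul (by fun_prop) continuous_besselSymbol) (C := 1) fun ξ => by
      have := lapSymbol_nonneg ξ
      refine norm_mul_besselSymbol_le ?_
      nlinarith [norm_two_pi_I_mul ξ j, sq_nonneg (‖2 * Real.pi * Complex.I * (ξ j : ℂ)‖ - 1)]

lemma memLp_deriv₂_symbol (ij : Fin n × Fin n) :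
    MemLp (fun ξ : Rn n => 2 * Real.pi * Complex.I * (ξ ij.1 : ℂ) *
      (2 * Real.pi * Complex.I * (ξ ij.2 : ℂ) * besselSymbol ξ)) ∞ volume :=
  memLp_top_of_continuous
    (Continuous.mul (by fun_prop) (Continuous.mul (by fun_prop) continuous_besselSymbol)) (C := 1)
    fun ξ => by
      have := lapSymbol_nonneg ξ
      rw [← mul_assoc]
      refine norm_mul_besselSymbol_le ?_
      rw [norm_mul]
      nlinarith [norm_two_pi_I_mul ξ ij.1, norm_two_pi_I_mul ξ ij.2,
        sq_nonneg (‖2 * Real.pi * Complex.I * (ξ ij.1 : ℂ)‖ -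
          ‖2 * Real.pi * Complex.I * (ξ ij.2 : ℂ)‖)]

/-- The operator `(1 - Δ)⁻¹ : L²(ℝⁿ) → H²(ℝⁿ)`. -/
def bessel (n : ℕ) : L2 n →L[ℂ] H2 n :=
  H2.lift (fmul _ memLp_besselSymbol) (fun j => fmul _ (memLp_deriv₁_symbol j))
    (fun ij => fmul _ (memLp_deriv₂_symbol ij))
    (fun j u => by
      rw [isPartial_iff_fourier]
      filter_upwards [coeFn_FT_fmul _ (memLp_deriv₁_symbol j) u,
        coeFn_FT_fmul _ memLp_besselSymbol u] with ξ h1 h2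
      rw [h1, h2, mul_assoc])
    (fun i j u => by
      rw [isPartial_iff_fourier]
      filter_upwards [coeFn_FT_fmul _ (memLp_deriv₁_symbol j) u,
        coeFn_FT_fmul _ (memLp_deriv₂_symbol (i, j)) u] with ξ h1 h2
      rw [h1, h2, mul_assoc])

/-- The operator `(1 - Δ)⁻¹` on `L²(ℝⁿ)`. -/
def besselL2 (n : ℕ) : L2 n →L[ℂ] L2 n := fmul besselSymbol memLp_besselSymbol

lemma incl_comp_bessel : H2.incl n ∘L bessel n = besselL2 n := H2.incl_lift _ _ _ _ _

lemma coeFn_sum_L2 {ι : Type*} (s : Finset ι) (u : ι → L2 n) :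
    (∑ i ∈ s, u i : L2 n) =ᵐ[volume] fun x => ∑ i ∈ s, u i x := by
  classical
  induction s using Finset.induction_on with
  | empty => exact .of_forall fun x => by simp
  | insert a s ha ih =>
    rw [Finset.sum_insert ha]
    filter_upwards [ih, Lp.coeFn_add (u a) (∑ i ∈ s, u i)] with x h1 h2
    rw [h2, Pi.add_apply, h1, Finset.sum_insert ha]

lemma coeFn_FT_lapOp (U : H2 n) :
    FT n (lapOp n U) =ᵐ[volume] fun ξ => -(lapSymbol ξ : ℂ) * FT n (H2.incl n U) ξ := by
  have h2 : ∀ i : Fin n, FT n (H2.deriv₂ i i U) =ᵐ[volume] fun ξ =>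
      (2 * Real.pi * Complex.I * (ξ i : ℂ)) ^ 2 * FT n (H2.incl n U) ξ := by
    intro i
    filter_upwards [isPartial_iff_fourier.1 (H2.isPartial_incl U i),
      isPartial_iff_fourier.1 (H2.isPartial_deriv₁ U i i)] with ξ h1 h2
    rw [h2, h1]
    ring
  have h3 : FT n (lapOp n U) = ∑ i, FT n (H2.deriv₂ i i U) := by
    rw [lapOp, sum_apply, map_sum]
  rw [h3]
  have h4 := coeFn_sum_L2 Finset.univ (fun i => FT n (H2.deriv₂ i i U))
  filter_upwards [h4, ae_all_iff.2 h2] with ξ h5 h6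
  rw [h5, Finset.sum_congr rfl fun i _ => h6 i, ← Finset.sum_mul]
  congr 1
  rw [lapSymbol, EuclideanSpace.norm_sq_eq]
  simp only [Real.norm_eq_abs, sq_abs]
  push_cast
  rw [Finset.mul_sum, ← Finset.sum_neg_distrib]
  refine Finset.sum_congr rfl fun i _ => ?_
  rw [mul_pow, mul_pow, Complex.I_sq]
  ring

lemma bessel_comp_sub : bessel n ∘L (H2.incl n - lapOp n) = 1 := by
  ext1 U
  apply incl_injective
  change (H2.incl n ∘L bessel n) ((H2.incl n - lapOp n) U) = _
  rw [incl_comp_bessel]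
  apply fmul_eq_of_ae
  have : FT n ((H2.incl n - lapOp n) U) = FT n (H2.incl n U) - FT n (lapOp n U) := map_sub _ _ _
  rw [this]
  filter_upwards [coeFn_FT_lapOp U, Lp.coeFn_sub (FT n (H2.incl n U)) (FT n (lapOp n U))]
    with ξ h1 h2
  rw [h2, Pi.sub_apply, h1, besselSymbol]
  have := one_add_lapSymbol_ne_zero ξ
  change FT n (H2.incl n U) ξ = _
  field_simp
  ring

lemma lapOp_comp_bessel : lapOp n ∘L bessel n = besselL2 n - 1 := by
  ext1 u
  apply (FT n).injective
  apply Lp.ext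
  have h0 : FT n ((besselL2 n - 1) u) = FT n (besselL2 n u) - FT n u := map_sub _ _ _
  rw [h0]
  have h3 : FT n (H2.incl n (bessel n u)) = FT n (besselL2 n u) := by
    rw [← incl_comp_bessel]; rfl
  have h4 := coeFn_FT_lapOp (bessel n u)
  rw [h3] at h4
  filter_upwards [h4, Lp.coeFn_sub (FT n (besselL2 n u)) (FT n u),
    coeFn_FT_fmul _ memLp_besselSymbol u] with ξ h1 h2 h5
  rw [ContinuousLinearMap.comp_apply, h1, h2, Pi.sub_apply, besselL2, h5, besselSymbol]
  have := one_add_lapSymbol_ne_zero ξ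
  field_simp
  ring

/-- `1 - Δ` as a topological isomorphism of `H²(ℝⁿ)` onto `L²(ℝⁿ)`, in the direction of its
inverse. -/
def besselEquiv (n : ℕ) : L2 n ≃L[ℂ] H2 n :=
  ContinuousLinearEquiv.equivOfInverse' (bessel n) (H2.incl n - lapOp n) bessel_comp_sub (by
    rw [ContinuousLinearMap.sub_comp, incl_comp_bessel, lapOp_comp_bessel]; exact sub_sub_cancel _ _)

/-- `1 - Δ : H²(ℝⁿ) → L²(ℝⁿ)`. -/
def oneSubLap (n : ℕ) : H2 n →L[ℂ] L2 n := H2.incl n - lapOp n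

lemma bessel_oneSubLap (U : H2 n) : bessel n (oneSubLap n U) = U := congr($bessel_comp_sub U)

lemma incl_bessel (u : L2 n) : H2.incl n (bessel n u) = besselL2 n u := congr($incl_comp_bessel u)

lemma besselL2_oneSubLap (U : H2 n) : besselL2 n (oneSubLap n U) = H2.incl n U := by
  rw [← incl_bessel, bessel_oneSubLap]

/-- Multiplication by a function in `C₀^∞(ℝⁿ)` on `H²(ℝⁿ)`, transported to `L²(ℝⁿ)` by the
isomorphism `(1 - Δ)⁻¹`. -/
def mulBessel {φ : Rn n → ℂ} (h : IsCutoff φ) : L2 n →L[ℂ] L2 n :=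
  oneSubLap n ∘L mulH2 h ∘L bessel n

lemma besselL2_comp_mulBessel {φ : Rn n → ℂ} (h : IsCutoff φ) :
    besselL2 n ∘L mulBessel h = mulOp φ h.bdd ∘L besselL2 n := by
  ext1 u
  refine (besselL2_oneSubLap _).trans ?_
  refine congr($(incl_comp_mulH2 h) (bessel n u)).trans ?_
  exact congrArg (mulOp φ h.bdd) (incl_bessel u)

/-! ### Resolvents off the spectrum -/

lemma inner_fmul_left {b : Rn n → ℂ} (hb : MemLp b ∞ volume) (hr : ∀ᵐ x, (b x).im = 0)
    (u v : L2 n) : inner ℂ (fmul b hb u) v = inner ℂ u (fmul b hb v) := by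
  rw [← (FT n).inner_map_map, ← (FT n).inner_map_map u, FT_fmul, FT_fmul, inner_mulOp_left hb hr]

lemma besselSymbol_im (ξ : Rn n) : (besselSymbol ξ).im = 0 := by
  rw [besselSymbol, ← Complex.ofReal_one, ← Complex.ofReal_add, ← Complex.ofReal_inv,
    Complex.ofReal_im]

/-- `-Δ` is a nonnegative symmetric form on `H²(ℝⁿ)`. -/
lemma inner_lapOp (U : H2 n) :
    ∃ a : ℝ, 0 ≤ a ∧ inner ℂ (H2.incl n U) (lapOp n U) = ((-a : ℝ) : ℂ) := by
  refine ⟨∫ ξ, lapSymbol ξ * ‖FT n (H2.incl n U) ξ‖ ^ 2, integral_nonneg fun ξ =>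
    mul_nonneg (lapSymbol_nonneg ξ) (by positivity), ?_⟩
  rw [← (FT n).inner_map_map, L2.inner_def, ← integral_neg, ← integral_complex_ofReal]
  apply integral_congr_ae
  filter_upwards [coeFn_FT_lapOp U] with ξ h
  rw [h, RCLike.inner_apply, mul_assoc, Complex.mul_conj, Complex.normSq_eq_norm_sq]
  push_cast
  ring

/-- The spectral parameters outside `[0, ∞)`. -/
def offSpectrum (z : ℂ) : Prop := z.im ≠ 0 ∨ z.re < 0

lemma offSpectrum.conj {z : ℂ} (h : offSpectrum z) : offSpectrum ((starRingEnd ℂ) z) := by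
  simpa [offSpectrum] using h

lemma offSpectrum_sq {lam : ℂ} (h : 0 < lam.im) : offSpectrum (lam ^ 2) := by
  by_cases hr : lam.re = 0
  · right
    simp only [sq, Complex.mul_re, hr]
    nlinarith
  · left
    have : (lam ^ 2).im = 2 * (lam.re * lam.im) := by simp [sq, Complex.mul_im]; ring
    rw [this]
    positivity

/-- A point off the half-line keeps a definite angle from it. -/
lemma offSpectrum.bound {z : ℂ} (h : offSpectrum z) :
    ∃ d : ℝ, 0 < d ∧ ∀ a b : ℝ, 0 ≤ a → 0 ≤ b → d * b ≤ ‖(a : ℂ) - z * b‖ := by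
  by_cases hi : z.im = 0
  · have hr : z.re < 0 := h.resolve_left (not_not.2 hi)
    refine ⟨-z.re, by linarith, fun a b ha hb => ?_⟩
    refine le_trans ?_ (Complex.re_le_norm _)
    simp
    nlinarith
  · refine ⟨|z.im|, abs_pos.2 hi, fun a b ha hb => ?_⟩
    refine le_trans ?_ (Complex.abs_im_le_norm _)
    simp [abs_mul, abs_of_nonneg hb]

/-- The operator `-Δ - z w : H²(ℝⁿ) → L²(ℝⁿ)`. -/
def hamOp (w : Rn n → ℂ) (hw : MemLp w ∞ volume) (z : ℂ) : H2 n →L[ℂ] L2 n :=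
  -lapOp n - z • (mulOp w hw ∘L H2.incl n)

/-- The weight `w` is real and bounded from below by a positive constant. -/
def PosWeight (w : Rn n → ℂ) : Prop :=
  (∀ᵐ x, (w x).im = 0) ∧ ∃ δ : ℝ, 0 < δ ∧ ∀ᵐ x, δ ≤ (w x).re

lemma hamOp_lower_bound {w : Rn n → ℂ} (hw : MemLp w ∞ volume) (hp : PosWeight w) {z : ℂ}
    (hz : offSpectrum z) :
    ∃ C : ℝ, 0 < C ∧ ∀ U, ‖H2.incl n U‖ ≤ C * ‖hamOp w hw z U‖ := by
  obtain ⟨hr, δ, hδ, hge⟩ := hp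
  obtain ⟨d, hd, hb⟩ := hz.bound
  refine ⟨(d * δ)⁻¹, by positivity, fun U => ?_⟩
  obtain ⟨a, ha, hin⟩ := inner_lapOp U
  obtain ⟨h1, h2⟩ := inner_mulOp_self_ge hw hr hge (H2.incl n U)
  set u := H2.incl n U
  set b := (inner ℂ u (mulOp w hw u)).re with hbdef
  have hb0 : 0 ≤ b := le_trans (by positivity) h1
  have e1 : inner ℂ u (mulOp w hw u) = (b : ℂ) := Complex.ext (by simp [hbdef]) (by simp [h2])
  have e2 : inner ℂ u (hamOp w hw z U) = (a : ℂ) - z * b := by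
    have : hamOp w hw z U = -lapOp n U - z • mulOp w hw u := rfl
    rw [this, inner_sub_right, inner_neg_right, inner_smul_right, hin, e1]
    push_cast; ring
  have h3 : d * (δ * ‖u‖ ^ 2) ≤ ‖u‖ * ‖hamOp w hw z U‖ :=
    calc d * (δ * ‖u‖ ^ 2) ≤ d * b := by gcongr
      _ ≤ ‖(a : ℂ) - z * b‖ := hb a b ha hb0
      _ = ‖inner ℂ u (hamOp w hw z U)‖ := by rw [e2]
      _ ≤ _ := norm_inner_le_norm _ _
  rw [inv_mul_eq_div, le_div_iff₀ (by positivity)]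
  rcases (norm_nonneg u).eq_or_lt with h0 | h0
  · rw [← h0]; simp
  · nlinarith

lemma hamOp_comp_bessel {w : Rn n → ℂ} (hw : MemLp w ∞ volume) (z : ℂ) (f : L2 n) :
    hamOp w hw z (bessel n f) =
      f - besselL2 n f - z • mulOp w hw (besselL2 n f) := by
  have h1 : lapOp n (bessel n f) = besselL2 n f - f := congr($lapOp_comp_bessel f)
  have h2 : H2.incl n (bessel n f) = besselL2 n f := congr($incl_comp_bessel f)
  have : hamOp w hw z (bessel n f) =
    -lapOp n (bessel n f) - z • mulOp w hw (H2.incl n (bessel n f)) := rfl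
  rw [this, h1, h2, neg_sub]

/-- `-Δ - z w : H²(ℝⁿ) → L²(ℝⁿ)` is invertible for `z ∉ [0, ∞)`: the quadratic form bounds it from
below, and so does its adjoint, which has the same structure. -/
theorem hamOp_isInvertible {w : Rn n → ℂ} (hw : MemLp w ∞ volume) (hp : PosWeight w) {z : ℂ}
    (hz : offSpectrum z) : (hamOp w hw z).IsInvertible := by
  set T : L2 n →L[ℂ] L2 n := hamOp w hw z ∘L bessel n with hT
  have hTf : ∀ f, T f = f - besselL2 n f - z • mulOp w hw (besselL2 n f) :=
    hamOp_comp_bessel hw z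
  have hincl : ∀ f, H2.incl n (bessel n f) = besselL2 n f := fun f => congr($incl_comp_bessel f)
  -- the lower bound for `-Δ - z w` controls `(1 - Δ)⁻¹ f`, hence also `f`
  have hanti : ∃ C : ℝ, 0 < C ∧ ∀ f, ‖f‖ ≤ C * ‖T f‖ := by
    obtain ⟨C, hC, h⟩ := hamOp_lower_bound hw hp hz
    refine ⟨1 + C + ‖z‖ * (‖mulOp w hw‖ * C), by positivity, fun f => ?_⟩
    have h1 : ‖besselL2 n f‖ ≤ C * ‖T f‖ := by rw [← hincl]; exact h _
    have h2 : f = T f + besselL2 n f + z • mulOp w hw (besselL2 n f) := by rw [hTf]; abel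
    have h3 : ‖mulOp w hw (besselL2 n f)‖ ≤ ‖mulOp w hw‖ * (C * ‖T f‖) :=
      (ContinuousLinearMap.le_opNorm _ _).trans (by gcongr)
    calc ‖f‖ ≤ ‖T f‖ + ‖besselL2 n f‖ + ‖z • mulOp w hw (besselL2 n f)‖ := by
          conv_lhs => rw [h2]
          exact norm_add₃_le
      _ ≤ ‖T f‖ + C * ‖T f‖ + ‖z‖ * (‖mulOp w hw‖ * (C * ‖T f‖)) := by
          rw [norm_smul]; gcongr
      _ = _ := by ring
  obtain ⟨C, hC, hbound⟩ := hanti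
  have hal : AntilipschitzWith ⟨C, hC.le⟩ T := T.antilipschitz_of_bound hbound
  have hclosed : IsClosed (Set.range T) := hal.isClosed_range T.uniformContinuous
  have hperp : (T.range)ᗮ = ⊥ := by
    rw [Submodule.eq_bot_iff]
    intro g hg
    have hg' : ∀ f, inner ℂ (T f) g = 0 := fun f =>
      (Submodule.mem_orthogonal _ _).1 hg _ ⟨f, rfl⟩
    -- orthogonality to the range means `g = (1 - Δ)⁻¹ (g + z̄ w g)`: so `g` lies in `H²(ℝⁿ)` and is
    -- annihilated by `-Δ - z̄ w`
    set h := g + (starRingEnd ℂ) z • mulOp w hw g with hh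
    have hK : g = besselL2 n h := by
      rw [← sub_eq_zero]
      refine ext_inner_left ℂ fun f => ?_
      have h1 := hg' f
      rw [hTf, inner_sub_left, inner_sub_left, inner_smul_left, inner_mulOp_left hw hp.1, besselL2,
        inner_fmul_left memLp_besselSymbol (.of_forall besselSymbol_im),
        inner_fmul_left memLp_besselSymbol (.of_forall besselSymbol_im)] at h1
      rw [hh, map_add, map_smul, inner_zero_right, inner_sub_right, inner_add_right,
        inner_smul_right, ← h1, besselL2]
      ring
    obtain ⟨C', hC', hb'⟩ := hamOp_lower_bound hw hp hz.conj
    have h0 : hamOp w hw ((starRingEnd ℂ) z) (bessel n h) = 0 := by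
      rw [hamOp_comp_bessel, ← hK, hh]; abel
    have := hb' (bessel n h)
    rw [h0, norm_zero, mul_zero, hincl, ← hK] at this
    exact norm_le_zero_iff.1 this
  have hsurj : T.range = ⊤ := by
    have h1 := (Submodule.topologicalClosure_eq_top_iff (K := T.range)).2 hperp
    rwa [IsClosed.submodule_topologicalClosure_eq (by rw [LinearMap.coe_range]; exact hclosed)] at h1
  set e := ContinuousLinearEquiv.ofBijective T (LinearMap.ker_eq_bot.2 hal.injective) hsurj
  refine ⟨(besselEquiv n).symm.trans e, ?_⟩
  ext1 U
  change T ((besselEquiv n).symm U) = _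
  change hamOp w hw z ((besselEquiv n) ((besselEquiv n).symm U)) = _
  rw [ContinuousLinearEquiv.apply_symm_apply]

section

/-! ### Continuation of Cauchy-type integrals over `[0, 1]` -/

variable {X : Type*} [NormedAddCommGroup X] [NormedSpace ℂ X] [CompleteSpace X]

/-- An integral over a compact set of entire functions, jointly continuous in the parameter, is
entire. -/
theorem differentiable_setIntegral_of_continuous {α : Type*} [TopologicalSpace α]
    [MeasurableSpace α] [BorelSpace α] [SecondCountableTopology α] {ν : Measure α}
    [IsFiniteMeasureOnCompacts ν] {K : Set α} (hK : IsCompact K) (hKm : MeasurableSet K)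
    {F : α → ℂ → X} (hc : Continuous F.uncurry) (hd : ∀ a, Differentiable ℂ (F a)) :
    Differentiable ℂ (fun z => ∫ a in K, F a z ∂ν) := by
  intro z₀
  have hcz : ∀ z, Continuous fun a => F a z := fun z =>
    hc.comp (continuous_id.prodMk continuous_const)
  obtain ⟨C, hC⟩ := (hK.prod (isCompact_closedBall z₀ 2)).exists_bound_of_continuousOn
    hc.continuousOn
  have hmeas : AEStronglyMeasurable (fun a => deriv (F a) z₀) (ν.restrict K) := by
    have h1 : StronglyMeasurable fun p : α × ℂ => deriv (F p.1) p.2 :=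
      stronglyMeasurable_deriv_with_param hc
    exact (h1.comp_measurable (measurable_id.prodMk measurable_const)).aestronglyMeasurable
  have hbound : ∀ᵐ a ∂(ν.restrict K), ∀ z ∈ Metric.ball z₀ 1, ‖deriv (F a) z‖ ≤ C / 1 := by
    filter_upwards [ae_restrict_mem hKm] with a ha z hz
    refine Complex.norm_deriv_le_of_forall_mem_sphere_norm_le one_pos (hd a).diffContOnCl ?_
    intro w hw
    refine hC (a, w) ⟨ha, ?_⟩
    have h1 := dist_triangle w z z₀
    have h2 : dist w z = 1 := hw
    have h3 : dist z z₀ < 1 := hz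
    change dist w z₀ ≤ 2
    linarith
  have : IsFiniteMeasure (ν.restrict K) := ⟨by
    rw [Measure.restrict_apply_univ]; exact hK.measure_lt_top⟩
  have := hasDerivAt_integral_of_dominated_loc_of_deriv_le (μ := ν.restrict K)
    (F := fun z a => F a z) (F' := fun z a => deriv (F a) z) (x₀ := z₀) (bound := fun _ => C / 1)
    (Metric.ball_mem_nhds z₀ one_pos)
    (.of_forall fun z => (hcz z).aestronglyMeasurable)
    ((hcz z₀).continuousOn.integrableOn_compact' hK hKm) hmeas hbound
    (integrable_const _) (.of_forall fun a z _ => (hd a z).hasDerivAt)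
  exact this.2.differentiableAt

/-- For an entire function, the difference quotient is an average of derivatives. -/
lemma dslope_eq_integral {h : ℂ → X} (hh : Differentiable ℂ h) (a b : ℂ) :
    dslope h a b = ∫ t in (0 : ℝ)..1, deriv h (a + t • (b - a)) := by
  have hdc : Continuous (deriv h) := (hh.contDiff (n := 1)).continuous_deriv le_rfl
  have key := intervalIntegral.integral_unitInterval_deriv_eq_sub (𝕜 := ℂ) (f := h)
    (f' := deriv h) (z₀ := a) (z₁ := b - a) (hdc.comp (by fun_prop)).continuousOn
    fun t _ => (hh _).hasDerivAt
  rcases eq_or_ne b a with rfl | hne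
  · simp
  · rw [dslope_of_ne _ hne, slope_def_module]
    rw [add_sub_cancel] at key
    rw [← key, inv_smul_smul₀ (sub_ne_zero.2 hne)]

/-- The function `μ ↦ ∫₀¹ (h r - h μ) / (r - μ) dr`. -/
def cauchyDiff (h : ℂ → X) (μ : ℂ) : X := ∫ r in Set.Icc (0 : ℝ) 1, dslope h (r : ℂ) μ

lemma continuous_dslope_uncurry {h : ℂ → X} (hh : Differentiable ℂ h) :
    Continuous (Function.uncurry fun (r : ℝ) (μ : ℂ) => dslope h (r : ℂ) μ) := by
  have hdc : Continuous (deriv h) := (hh.contDiff (n := 1)).continuous_deriv le_rfl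
  simp only [Function.uncurry_def, dslope_eq_integral hh]
  exact intervalIntegral.continuous_parametric_intervalIntegral_of_continuous'
    (f := fun (p : ℝ × ℂ) (t : ℝ) => deriv h (p.1 + t • (p.2 - p.1)))
    (hdc.comp (by fun_prop)) 0 1

lemma differentiable_cauchyDiff {h : ℂ → X} (hh : Differentiable ℂ h) :
    Differentiable ℂ (cauchyDiff h) := by
  refine differentiable_setIntegral_of_continuous isCompact_Icc measurableSet_Icc
    (continuous_dslope_uncurry hh) fun r => ?_
  rw [← differentiableOn_univ, Complex.differentiableOn_dslope Filter.univ_mem]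
  exact hh.differentiableOn

lemma integral_cauchy_eq {h : ℂ → X} (hh : Differentiable ℂ h) {μ : ℂ} (hμ : μ.im ≠ 0) :
    ∫ r in (0 : ℝ)..1, ((r : ℂ) - μ)⁻¹ • h r =
      cauchyDiff h μ + (∫ r in (0 : ℝ)..1, ((r : ℂ) - μ)⁻¹) • h μ := by
  have hne : ∀ r : ℝ, (r : ℂ) - μ ≠ 0 := fun r h0 => hμ (by
    rw [← sub_eq_zero.1 h0, Complex.ofReal_im])
  have hci : Continuous fun r : ℝ => ((r : ℂ) - μ)⁻¹ :=
    (Complex.continuous_ofReal.sub continuous_const).inv₀ hne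
  have hs : Continuous fun r : ℝ => ((r : ℂ) - μ)⁻¹ • h μ := hci.smul continuous_const
  have hd : Continuous fun r : ℝ => dslope h (r : ℂ) μ :=
    (continuous_dslope_uncurry hh).comp (continuous_id.prodMk continuous_const)
  rw [cauchyDiff, integral_Icc_eq_integral_Ioc, ← intervalIntegral.integral_of_le zero_le_one,
    ← intervalIntegral.integral_smul_const, ← intervalIntegral.integral_add
      (hd.intervalIntegrable _ _) (hs.intervalIntegrable _ _)]
  refine intervalIntegral.integral_congr fun r _ => ?_
  have h1 : μ ≠ r := fun e => hne r (by rw [e, sub_self])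
  rw [dslope_of_ne _ h1, slope_def_module, ← neg_sub (r : ℂ) μ, inv_neg, neg_smul, ← smul_neg,
    neg_sub, smul_sub, sub_add_cancel]

lemma neg_I_mul_mem_slitPlane {μ : ℂ} (h : μ ∉ negImagAxis) : -Complex.I * μ ∈ Complex.slitPlane := by
  rw [Complex.mem_slitPlane_iff]
  simp only [negImagAxis, Set.mem_ofPred_eq, not_and_or, not_le] at h
  simp
  tauto

/-- The continuation of `∫₀¹ dr / (r - μ)` from the upper half-plane. The factors `± i` choose
branches for which the first term is analytic for `|μ| < 1`, and the second one is cut exactly along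
`negImagAxis`. -/
def logMinus (μ : ℂ) : ℂ := Complex.log (Complex.I * (1 - μ)) - Complex.log (-Complex.I * μ)

/-- The continuation of `∫₀¹ dr / (r + μ)` from the upper half-plane. -/
def logPlus (μ : ℂ) : ℂ := Complex.log (-Complex.I * (1 + μ)) - Complex.log (-Complex.I * μ)

lemma integral_inv_sub {μ : ℂ} (hμ : 0 < μ.im) :
    ∫ r in (0 : ℝ)..1, ((r : ℂ) - μ)⁻¹ = logMinus μ := by
  -- `i (r - μ)` stays in the right half-plane, where the principal logarithm is a primitive
  have hsl : ∀ r : ℝ, Complex.I * (r - μ) ∈ Complex.slitPlane := fun r => by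
    rw [Complex.mem_slitPlane_iff]; left; simpa
  have hne : ∀ r : ℝ, (r : ℂ) - μ ≠ 0 := fun r h0 => by
    have := Complex.slitPlane_ne_zero (hsl r); simp [h0] at this
  have hci : Continuous fun r : ℝ => ((r : ℂ) - μ)⁻¹ :=
    (Complex.continuous_ofReal.sub continuous_const).inv₀ hne
  rw [intervalIntegral.integral_eq_sub_of_hasDerivAt
    (f := fun r : ℝ => Complex.log (Complex.I * (r - μ))) ?_ (hci.intervalIntegrable _ _)]
  · simp [logMinus]
  · intro r _
    have h1 : HasDerivAt (fun r : ℝ => Complex.I * ((r : ℂ) - μ)) (Complex.I * 1) r :=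
      ((Complex.ofRealCLM.hasDerivAt (x := r)).sub_const μ).const_mul Complex.I
    have h2 := h1.clog_real (hsl r)
    rwa [mul_div_mul_left _ _ Complex.I_ne_zero, one_div] at h2

lemma integral_inv_add {μ : ℂ} (hμ : 0 < μ.im) :
    ∫ r in (0 : ℝ)..1, ((r : ℂ) - -μ)⁻¹ = logPlus μ := by
  have hsl : ∀ r : ℝ, -Complex.I * (r + μ) ∈ Complex.slitPlane := fun r => by
    rw [Complex.mem_slitPlane_iff]; left; simpa
  have hne : ∀ r : ℝ, (r : ℂ) + μ ≠ 0 := fun r h0 => by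
    have := Complex.slitPlane_ne_zero (hsl r); simp [h0] at this
  have hci : Continuous fun r : ℝ => ((r : ℂ) + μ)⁻¹ :=
    (Complex.continuous_ofReal.add continuous_const).inv₀ hne
  simp only [sub_neg_eq_add]
  rw [intervalIntegral.integral_eq_sub_of_hasDerivAt
    (f := fun r : ℝ => Complex.log (-Complex.I * (r + μ))) ?_ (hci.intervalIntegrable _ _)]
  · simp [logPlus]
  · intro r _
    have h1 : HasDerivAt (fun r : ℝ => -Complex.I * ((r : ℂ) + μ)) (-Complex.I * 1) r :=
      ((Complex.ofRealCLM.hasDerivAt (x := r)).add_const μ).const_mul (-Complex.I)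
    have h2 := h1.clog_real (hsl r)
    rwa [mul_div_mul_left _ _ (neg_ne_zero.2 Complex.I_ne_zero), one_div] at h2

lemma I_mul_one_sub_mem_slitPlane {μ : ℂ} (h : ‖μ‖ < 1) :
    Complex.I * (1 - μ) ∈ Complex.slitPlane := by
  have := (abs_le.1 (Complex.abs_re_le_norm μ)).2
  rw [Complex.mem_slitPlane_iff]; right
  simp
  linarith

lemma neg_I_mul_one_add_mem_slitPlane {μ : ℂ} (h : ‖μ‖ < 1) :
    -Complex.I * (1 + μ) ∈ Complex.slitPlane := by
  have := (abs_le.1 (Complex.abs_re_le_norm μ)).1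
  rw [Complex.mem_slitPlane_iff]; right
  simp
  linarith

/-- The continuation of `μ ↦ ∫₀¹ h r / (r² - μ²) dr` from the upper half-plane, by partial
fractions. -/
def radialCont (h : ℂ → X) (μ : ℂ) : X :=
  (2 * μ)⁻¹ • (cauchyDiff h μ - cauchyDiff h (-μ)) +
    (2 * μ)⁻¹ • (logMinus μ • h μ - logPlus μ • h (-μ))

lemma isClosed_negImagAxis : IsClosed negImagAxis :=
  (isClosed_eq Complex.continuous_re continuous_const).inter
    (isClosed_le Complex.continuous_im continuous_const)

lemma ne_zero_of_notMem_negImagAxis {μ : ℂ} (h : μ ∉ negImagAxis) : μ ≠ 0 := by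
  rintro rfl; exact h ⟨rfl, le_rfl⟩

lemma analyticOnNhd_radialCont {h : ℂ → X} (hh : Differentiable ℂ h) :
    AnalyticOnNhd ℂ (radialCont h) (Metric.ball 0 1 \ negImagAxis) := by
  refine DifferentiableOn.analyticOnNhd (fun μ hμ => ?_)
    (Metric.isOpen_ball.sdiff isClosed_negImagAxis)
  have h0 := ne_zero_of_notMem_negImagAxis hμ.2
  have h1 : ‖μ‖ < 1 := by simpa using hμ.1
  have d1 : DifferentiableAt ℂ (fun μ : ℂ => (2 * μ)⁻¹) μ :=
    (differentiableAt_id.const_mul 2).inv (by simpa using h0)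
  have d2 : DifferentiableAt ℂ (cauchyDiff h) μ := differentiable_cauchyDiff hh μ
  have d3 : DifferentiableAt ℂ (fun μ => cauchyDiff h (-μ)) μ :=
    ((differentiable_cauchyDiff hh).comp differentiable_neg) μ
  have d4 : DifferentiableAt ℂ (fun μ => h (-μ)) μ := (hh.comp differentiable_neg) μ
  have d5 : DifferentiableAt ℂ (fun μ => Complex.log (-Complex.I * μ)) μ :=
    (differentiableAt_id.const_mul _).clog (neg_I_mul_mem_slitPlane hμ.2)
  have d6 : DifferentiableAt ℂ logMinus μ :=
    DifferentiableAt.sub (((differentiableAt_const _).sub differentiableAt_id).const_mul _ |>.clog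
      (I_mul_one_sub_mem_slitPlane h1)) d5
  have d7 : DifferentiableAt ℂ logPlus μ :=
    DifferentiableAt.sub (((differentiableAt_const _).add differentiableAt_id).const_mul _ |>.clog
      (neg_I_mul_one_add_mem_slitPlane h1)) d5
  exact ((d1.smul (d2.sub d3)).add
    (d1.smul ((d6.smul (hh μ)).sub (d7.smul d4)))).differentiableWithinAt

lemma radialCont_eq_integral {h : ℂ → X} (hh : Differentiable ℂ h) {μ : ℂ} (hμ : 0 < μ.im) :
    radialCont h μ = ∫ r in (0 : ℝ)..1, ((r : ℂ) ^ 2 - μ ^ 2)⁻¹ • h r := by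
  have h0 : μ ≠ 0 := by rintro rfl; simp at hμ
  have hne1 : ∀ r : ℝ, (r : ℂ) - μ ≠ 0 := fun r h0 => hμ.ne' (by
    rw [← sub_eq_zero.1 h0, Complex.ofReal_im])
  have hne2 : ∀ r : ℝ, (r : ℂ) - -μ ≠ 0 := fun r h0 => by
    have := sub_eq_zero.1 h0
    have := congrArg Complex.im this
    simp at this
    linarith
  have hci1 : Continuous fun r : ℝ => ((r : ℂ) - μ)⁻¹ • h r :=
    ((Complex.continuous_ofReal.sub continuous_const).inv₀ hne1).smul
      (hh.continuous.comp Complex.continuous_ofReal)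
  have hci2 : Continuous fun r : ℝ => ((r : ℂ) - -μ)⁻¹ • h r :=
    ((Complex.continuous_ofReal.sub continuous_const).inv₀ hne2).smul
      (hh.continuous.comp Complex.continuous_ofReal)
  have e1 := integral_cauchy_eq hh (μ := μ) hμ.ne'
  have e2 := integral_cauchy_eq hh (μ := -μ) (by simpa using hμ.ne')
  rw [integral_inv_sub hμ] at e1
  rw [integral_inv_add hμ] at e2
  have e3 : radialCont h μ = (2 * μ)⁻¹ • ((∫ r in (0 : ℝ)..1, ((r : ℂ) - μ)⁻¹ • h r) -
      ∫ r in (0 : ℝ)..1, ((r : ℂ) - -μ)⁻¹ • h r) := by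
    rw [e1, e2, radialCont, ← smul_add]
    congr 1
    abel
  rw [e3, ← intervalIntegral.integral_sub (hci1.intervalIntegrable _ _)
    (hci2.intervalIntegrable _ _), ← intervalIntegral.integral_smul]
  refine intervalIntegral.integral_congr fun r _ => ?_
  rw [← sub_smul, smul_smul]
  congr 1
  have a1 := hne1 r
  have a2 := hne2 r
  rw [sub_neg_eq_add] at a2 ⊢
  have a3 : (r : ℂ) ^ 2 - μ ^ 2 ≠ 0 := by
    rw [sq_sub_sq]; exact mul_ne_zero a2 a1
  field_simp
  ring

/-- If `h` vanishes to order `n - 1` at the origin, then the continuation of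
`∫₀¹ h r / (r² - μ²) dr` is bounded by `1 + |μ|^(n-2) |log μ|`. -/
theorem norm_radialCont_le {g : ℂ → X} (hg : Differentiable ℂ g) (hn : 2 ≤ n) :
    ∃ C : ℝ, 0 < C ∧ ∀ μ : ℂ, ‖μ‖ ≤ 1 / 2 → μ ∉ negImagAxis →
      ‖radialCont (fun z => z ^ (n - 1) • g z) μ‖ ≤
        C * (1 + ‖μ‖ ^ (n - 2) * ‖Complex.log (-Complex.I * μ)‖) := by
  set h : ℂ → X := fun z => z ^ (n - 1) • g z with hdef
  have hh : Differentiable ℂ h := (differentiable_id.pow _).smul hg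
  have hcpt := isCompact_closedBall (0 : ℂ) (1 / 2)
  have hA := differentiable_cauchyDiff hh
  have hAd : Continuous (deriv (cauchyDiff h)) := (hA.contDiff (n := 1)).continuous_deriv le_rfl
  obtain ⟨CA, hCA⟩ := hcpt.exists_bound_of_continuousOn hAd.continuousOn
  obtain ⟨Cg, hCg⟩ := hcpt.exists_bound_of_continuousOn hg.continuous.continuousOn
  have hlt : ∀ μ ∈ Metric.closedBall (0 : ℂ) (1 / 2), ‖μ‖ < 1 := fun μ hμ => by
    have : ‖μ‖ ≤ 1 / 2 := by simpa using hμ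
    linarith
  obtain ⟨C1, hC1⟩ := hcpt.exists_bound_of_continuousOn
    (f := fun μ => Complex.log (Complex.I * (1 - μ)))
    (ContinuousOn.clog (by fun_prop) fun μ hμ => I_mul_one_sub_mem_slitPlane (hlt μ hμ))
  obtain ⟨C2, hC2⟩ := hcpt.exists_bound_of_continuousOn
    (f := fun μ => Complex.log (-Complex.I * (1 + μ)))
    (ContinuousOn.clog (by fun_prop) fun μ hμ => neg_I_mul_one_add_mem_slitPlane (hlt μ hμ))
  have z0 : (0 : ℂ) ∈ Metric.closedBall (0 : ℂ) (1 / 2) := by simp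
  have hCA0 : 0 ≤ CA := (norm_nonneg _).trans (hCA 0 z0)
  have hCg0 : 0 ≤ Cg := (norm_nonneg _).trans (hCg 0 z0)
  have hC10 : 0 ≤ C1 := (norm_nonneg _).trans (hC1 0 z0)
  have hC20 : 0 ≤ C2 := (norm_nonneg _).trans (hC2 0 z0)
  refine ⟨CA + Cg * (C1 + C2) + Cg + 1, by positivity, fun μ hμ hμs => ?_⟩
  have h0 := ne_zero_of_notMem_negImagAxis hμs
  have hm : μ ∈ Metric.closedBall (0 : ℂ) (1 / 2) := by simpa using hμ
  have hm' : -μ ∈ Metric.closedBall (0 : ℂ) (1 / 2) := by simpa using hμ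
  have hpos : 0 < ‖μ‖ := norm_pos_iff.2 h0
  set ℓ := ‖Complex.log (-Complex.I * μ)‖ with hℓ
  -- the difference over `[-μ, μ]` compensates the factor `(2 μ)⁻¹`
  have b1 : ‖(2 * μ)⁻¹ • (cauchyDiff h μ - cauchyDiff h (-μ))‖ ≤ CA := by
    have := Convex.norm_image_sub_le_of_norm_deriv_le (fun x _ => hA x) hCA
      (convex_closedBall (0 : ℂ) (1 / 2)) hm' hm
    rw [norm_smul, norm_inv, inv_mul_le_iff₀ (norm_pos_iff.2 (mul_ne_zero two_ne_zero h0))]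
    refine this.trans (le_of_eq ?_)
    rw [sub_neg_eq_add, ← two_mul, mul_comm]
  have hp1 : ‖μ‖ ^ (n - 1) = ‖μ‖ * ‖μ‖ ^ (n - 2) := by
    rw [← pow_succ']; congr 1; omega
  have hb : ∀ (l : ℂ) (C' : ℝ) (ν : ℂ), ν ∈ Metric.closedBall (0 : ℂ) (1 / 2) → ‖ν‖ = ‖μ‖ →
      ‖l‖ ≤ C' + ℓ → ‖l • h ν‖ ≤ ‖μ‖ * (‖μ‖ ^ (n - 2) * ((C' + ℓ) * Cg)) := by
    intro l C' ν hν hνμ hl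
    have := hCg ν hν
    rw [hdef, norm_smul, norm_smul, norm_pow, hνμ, hp1]
    calc ‖l‖ * (‖μ‖ * ‖μ‖ ^ (n - 2) * ‖g ν‖) ≤ (C' + ℓ) * (‖μ‖ * ‖μ‖ ^ (n - 2) * Cg) := by
          gcongr
          exact (norm_nonneg _).trans hl
      _ = _ := by ring
  have b2 := hb (logMinus μ) C1 μ hm rfl ((norm_sub_le _ _).trans (by gcongr; exact hC1 μ hm))
  have b3 := hb (logPlus μ) C2 (-μ) hm' (norm_neg _)
    ((norm_sub_le _ _).trans (by gcongr; exact hC2 μ hm))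
  have b4 : ‖(2 * μ)⁻¹ • (logMinus μ • h μ - logPlus μ • h (-μ))‖ ≤
      ‖μ‖ ^ (n - 2) * ((C1 + C2 + 2 * ℓ) * Cg) / 2 := by
    rw [norm_smul, norm_inv, inv_mul_le_iff₀ (norm_pos_iff.2 (mul_ne_zero two_ne_zero h0))]
    refine ((norm_sub_le _ _).trans (add_le_add b2 b3)).trans (le_of_eq ?_)
    rw [norm_mul, Complex.norm_ofNat]
    ring
  have hpw : ‖μ‖ ^ (n - 2) ≤ 1 := pow_le_one₀ hpos.le (by linarith)
  have hpw0 : 0 ≤ ‖μ‖ ^ (n - 2) := by positivity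
  have hℓ0 : 0 ≤ ℓ := norm_nonneg _
  calc ‖radialCont h μ‖ ≤ CA + ‖μ‖ ^ (n - 2) * ((C1 + C2 + 2 * ℓ) * Cg) / 2 :=
        (norm_add_le _ _).trans (add_le_add b1 b4)
    _ = CA + ‖μ‖ ^ (n - 2) * (Cg * (C1 + C2)) / 2 + Cg * (‖μ‖ ^ (n - 2) * ℓ) := by ring
    _ ≤ CA + 1 * (Cg * (C1 + C2)) + Cg * (‖μ‖ ^ (n - 2) * ℓ) := by
        have : 0 ≤ ‖μ‖ ^ (n - 2) * (Cg * (C1 + C2)) := by positivity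
        have : ‖μ‖ ^ (n - 2) * (Cg * (C1 + C2)) ≤ 1 * (Cg * (C1 + C2)) := by gcongr
        linarith
    _ ≤ _ := by
        have : 0 ≤ ‖μ‖ ^ (n - 2) * ℓ := by positivity
        nlinarith [mul_nonneg hCA0 this, mul_nonneg (mul_nonneg hCg0 (add_nonneg hC10 hC20)) this]

end

section

/-! ### Polar coordinates and Fourier integrals -/

variable {X : Type*} [NormedAddCommGroup X] [NormedSpace ℂ X]

/-- Integration of a continuous function over the unit ball in polar coordinates. -/
theorem setIntegral_ball_eq_polar (hn : 1 ≤ n) {f : Rn n → X} (hf : Continuous f) :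
    ∫ ξ in Metric.ball (0 : Rn n) 1, f ξ =
      ∫ r in (0 : ℝ)..1, (r : ℂ) ^ (n - 1) •
        ∫ θ : Metric.sphere (0 : Rn n) 1, f (r • (θ : Rn n)) ∂(volume : Measure (Rn n)).toSphere := by
  have : Nonempty (Fin n) := ⟨⟨0, hn⟩⟩
  set ν := (volume : Measure (Rn n)).toSphere
  set F : Rn n → X := (Metric.ball (0 : Rn n) 1).indicator f with hF
  have hdim : Module.finrank ℝ (Rn n) = n := finrank_euclideanSpace_fin
  have hFi : Integrable F := by
    rw [hF, integrable_indicator_iff Metric.isOpen_ball.measurableSet]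
    exact (hf.continuousOn.integrableOn_compact (isCompact_closedBall _ _)).mono_set
      Metric.ball_subset_closedBall
  set G : Metric.sphere (0 : Rn n) 1 × Set.Ioi (0 : ℝ) → X := fun p => F ((p.2 : ℝ) • (p.1 : Rn n))
    with hG
  have hmp := (volume : Measure (Rn n)).measurePreserving_homeomorphUnitSphereProd
  have hemb := (homeomorphUnitSphereProd (Rn n)).measurableEmbedding
  have hcomp : ∀ x : ({0}ᶜ : Set (Rn n)), G (homeomorphUnitSphereProd (Rn n) x) = F x := by
    intro x
    have h1 := homeomorphUnitSphereProd_symm_apply_coe (Rn n) (homeomorphUnitSphereProd (Rn n) x)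
    rw [Homeomorph.symm_apply_apply] at h1
    rw [hG, h1]
  have hGi : Integrable G (ν.prod (Measure.volumeIoiPow (n - 1))) := by
    have h1 := hmp.integrable_comp_emb hemb (g := G)
    rw [hdim] at h1
    rw [← h1]
    have h2 : G ∘ homeomorphUnitSphereProd (Rn n) = F ∘ Subtype.val := funext hcomp
    rw [h2, ← integrableOn_iff_comap_subtypeVal (measurableSet_singleton _).compl]
    exact hFi.integrableOn
  have e1 : ∫ ξ, F ξ = ∫ p, G p ∂(ν.prod (Measure.volumeIoiPow (n - 1))) := by
    have h1 := hmp.integral_comp hemb G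
    rw [hdim] at h1
    rw [← h1]
    simp only [hcomp]
    rw [integral_subtype_comap (measurableSet_singleton _).compl F,
      restrict_compl_singleton]
  rw [← integral_indicator Metric.isOpen_ball.measurableSet, e1, integral_prod_symm _ hGi]
  set q : ℝ → X := fun r => ∫ θ : Metric.sphere (0 : Rn n) 1, F (r • (θ : Rn n)) ∂ν with hq
  have e2 : ∫ r : Set.Ioi (0 : ℝ), ∫ θ, G (θ, r) ∂ν ∂(Measure.volumeIoiPow (n - 1)) =
      ∫ r in Set.Ioi (0 : ℝ), Real.toNNReal (r ^ (n - 1)) • q r := by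
    simp only [Measure.volumeIoiPow, ENNReal.ofReal]
    rw [integral_withDensity_eq_integral_smul
      ((measurable_subtype_coe.pow_const _).real_toNNReal),
      integral_subtype_comap measurableSet_Ioi fun a ↦ Real.toNNReal (a ^ (n - 1)) • q a]
  have hq0 : ∀ r : ℝ, 1 ≤ r → q r = 0 := by
    intro r hr
    rw [hq]
    refine integral_eq_zero_of_ae (.of_forall fun θ => ?_)
    refine Set.indicator_of_notMem ?_ _
    have : ‖(θ : Rn n)‖ = 1 := by simp
    simp only [mem_ball_zero_iff, norm_smul, this, mul_one, Real.norm_eq_abs, not_lt]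
    exact hr.trans (le_abs_self r)
  have hq1 : ∀ r ∈ Set.Ioo (0 : ℝ) 1, q r = ∫ θ : Metric.sphere (0 : Rn n) 1, f (r • (θ : Rn n)) ∂ν := by
    intro r hr
    refine integral_congr_ae (.of_forall fun θ => ?_)
    refine Set.indicator_of_mem ?_ _
    have : ‖(θ : Rn n)‖ = 1 := by simp
    simp only [mem_ball_zero_iff, norm_smul, this, mul_one, Real.norm_eq_abs]
    rw [abs_of_pos hr.1]; exact hr.2
  rw [e2, intervalIntegral.integral_of_le zero_le_one, integral_Ioc_eq_integral_Ioo]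
  rw [← Set.Ioo_union_Ici_eq_Ioi (zero_lt_one' ℝ)]
  rw [integral_union_eq_left_of_forall (t := Set.Ici (1 : ℝ)) measurableSet_Ici
    fun r hr => by rw [hq0 r hr, smul_zero]]
  refine setIntegral_congr_fun measurableSet_Ioo fun r hr => ?_
  rw [hq1 r hr, NNReal.smul_def, Real.coe_toNNReal _ (pow_nonneg hr.1.le _), ← Complex.ofReal_pow,
    Complex.coe_smul]

/-- On `L¹ ∩ L²` the unitary Fourier transform is given by the Fourier integral. -/
theorem FT_eq_fourierIntegral {u : L2 n} (hu : Integrable (u : Rn n → ℂ)) :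
    FT n u =ᵐ[volume] 𝓕 (u : Rn n → ℂ) := by
  have hcont : Continuous (𝓕 (u : Rn n → ℂ)) :=
    VectorFourier.fourierIntegral_continuous Real.continuous_fourierChar
      (by exact continuous_inner) hu
  refine ae_eq_of_integral_contDiff_smul_eq ((Lp.memLp (FT n u)).locallyIntegrable (by norm_num))
    hcont.locallyIntegrable fun g hg hgs => ?_
  have h1 : HasCompactSupport (Complex.ofRealCLM ∘ g) := hgs.comp_left rfl
  have h2 : ContDiff ℝ ∞ (Complex.ofRealCLM ∘ g) := by fun_prop
  set G : 𝓢(Rn n, ℂ) := h1.toSchwartzMap h2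
  have hG : ∀ x, G x = g x := fun x => rfl
  have e1 := congr($(Lp.fourier_toTemperedDistribution_eq u) G)
  rw [TemperedDistribution.fourier_apply, Lp.toTemperedDistribution_apply,
    Lp.toTemperedDistribution_apply] at e1
  have e2 := VectorFourier.integral_fourierIntegral_smul_eq_flip (μ := volume) (ν := volume)
    (L := innerₗ (Rn n)) Real.continuous_fourierChar (by exact continuous_inner)
    (f := G) (g := (u : Rn n → ℂ)) G.integrable hu
  rw [flip_innerₗ] at e2
  have e3 : ∫ x, G x • FT n u x = ∫ x, G x • 𝓕 (u : Rn n → ℂ) x := by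
    refine Eq.trans ?_ e2
    refine Eq.trans e1.symm ?_
    rfl
  simpa [hG, Complex.real_smul] using e3

end

/-! ### Cut-off plane waves -/

/-- Multiplication by bounded continuous functions, as a homomorphism into the bounded operators on
`L²(ℝⁿ)`. -/
def mulHom (n : ℕ) : BoundedContinuousFunction (Rn n) ℂ →+* (L2 n →L[ℂ] L2 n) where
  toFun f := mulOp f (memLp_top_of_continuous f.continuous f.norm_coe_le_norm)
  map_one' := mulOp_eq_one _ (.of_forall fun _ => rfl)
  map_mul' _ _ := (mulOp_comp _ _ _ (.of_forall fun _ => rfl)).symm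
  map_zero' := by
    ext1 u
    apply mulOp_eq_of_ae
    filter_upwards [Lp.coeFn_zero ℂ 2 (volume : Measure (Rn n))] with x h
    simp
  map_add' _ _ := (mulOp_add _ _ _ (.of_forall fun _ => rfl)).symm

lemma mulHom_apply (f : BoundedContinuousFunction (Rn n) ℂ) :
    mulHom n f = mulOp f (memLp_top_of_continuous f.continuous f.norm_coe_le_norm) := rfl

lemma continuous_mulHom : Continuous (mulHom n) :=
  AddMonoidHomClass.continuous_of_bound (mulHom n) 1 fun f => by
    rw [one_mul]
    exact norm_mulOp_le _ (norm_nonneg _) (.of_forall f.norm_coe_le_norm)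

/-- A function in `C₀^∞(ℝⁿ)` as a bounded continuous function. -/
def IsCutoff.toBCF {φ : Rn n → ℂ} (h : IsCutoff φ) : BoundedContinuousFunction (Rn n) ℂ :=
  BoundedContinuousFunction.ofNormedAddCommGroup φ h.smooth.continuous
    (h.supp.exists_bound_of_continuous h.smooth.continuous).choose
    (h.supp.exists_bound_of_continuous h.smooth.continuous).choose_spec

/-- The exponential of a multiplication operator is multiplication by the exponential. -/
lemma exp_mulHom_apply (f : BoundedContinuousFunction (Rn n) ℂ) (u : L2 n) :
    NormedSpace.exp (mulHom n f) u =ᵐ[volume] fun x => Complex.exp (f x) * u x := by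
  -- the facts on `NormedSpace.exp` ask for a normed `ℚ`-algebra
  let _ := NormedAlgebra.restrictScalars ℚ ℂ (BoundedContinuousFunction (Rn n) ℂ)
  let _ := NormedAlgebra.restrictScalars ℚ ℂ (L2 n →L[ℂ] L2 n)
  rw [← NormedSpace.map_exp (mulHom n) continuous_mulHom f, mulHom_apply]
  filter_upwards [coeFn_mulOp _ (memLp_top_of_continuous (NormedSpace.exp f).continuous
    (NormedSpace.exp f).norm_coe_le_norm) u] with x hx
  rw [hx]
  congr 1
  let ev : BoundedContinuousFunction (Rn n) ℂ →+* ℂ :=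
    { toFun := fun g => g x
      map_one' := rfl
      map_mul' := fun _ _ => rfl
      map_zero' := rfl
      map_add' := fun _ _ => rfl }
  rw [Complex.exp_eq_exp_ℂ]
  exact NormedSpace.map_exp ev (BoundedContinuousFunction.evalCLM ℂ x).continuous f

/-- An operator that intertwines `b` and `a` intertwines their exponentials. -/
lemma comp_exp_of_intertwine {E F : Type*} [NormedAddCommGroup E] [NormedSpace ℂ E]
    [CompleteSpace E] [NormedAddCommGroup F] [NormedSpace ℂ F] [CompleteSpace F]
    {T : E →L[ℂ] F} {a : F →L[ℂ] F} {b : E →L[ℂ] E} (h : T ∘L b = a ∘L T) :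
    T ∘L NormedSpace.exp b = NormedSpace.exp a ∘L T := by
  have hp : ∀ k : ℕ, T ∘L (b ^ k) = (a ^ k) ∘L T := by
    intro k
    induction k with
    | zero => rfl
    | succ k ih =>
      rw [pow_succ, pow_succ']
      change (T ∘L (b ^ k)) ∘L b = (a * a ^ k) ∘L T
      rw [ih, ContinuousLinearMap.comp_assoc, h, ← ContinuousLinearMap.comp_assoc, ← pow_succ',
        pow_succ]
      rfl
  have h1 := (NormedSpace.exp_series_hasSum_exp' (𝕂 := ℂ) b).mapL
    ((ContinuousLinearMap.compL ℂ E E F) T)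
  have h2 := (NormedSpace.exp_series_hasSum_exp' (𝕂 := ℂ) a).mapL
    ((ContinuousLinearMap.compL ℂ E F F).flip T)
  have e : ∀ k : ℕ, T ∘L ((k.factorial : ℂ)⁻¹ • b ^ k) = ((k.factorial : ℂ)⁻¹ • a ^ k) ∘L T :=
    fun k => by rw [ContinuousLinearMap.comp_smul, ContinuousLinearMap.smul_comp, hp]
  simp only [ContinuousLinearMap.flip_apply, ContinuousLinearMap.compL_apply] at h1 h2
  simp only [e] at h1
  exact h1.unique h2

/-- The function `x ↦ 2 π i xⱼ η(x)`. -/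
def posFun (η : Rn n → ℂ) (j : Fin n) : Rn n → ℂ := fun x => 2 * Real.pi * Complex.I * (x j : ℂ) * η x

lemma IsCutoff.posFun {η : Rn n → ℂ} (h : IsCutoff η) (j : Fin n) : IsCutoff (posFun η j) where
  smooth := by
    refine ContDiff.mul (contDiff_const.mul ?_) h.smooth
    exact Complex.ofRealCLM.contDiff.comp (EuclideanSpace.proj (𝕜 := ℝ) j).contDiff
  supp := h.supp.mul_left

/-- Multiplication by `2 π i (x · θ) η(x)` on `L²(ℝⁿ)`. -/
def posL2 {η : Rn n → ℂ} (h : IsCutoff η) (θ : Rn n) : L2 n →L[ℂ] L2 n :=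
  ∑ j, (θ j : ℂ) • mulOp _ (h.posFun j).bdd

/-- Multiplication by `2 π i (x · θ) η(x)` on `H²(ℝⁿ)`, transported to `L²(ℝⁿ)`. -/
def posBessel {η : Rn n → ℂ} (h : IsCutoff η) (θ : Rn n) : L2 n →L[ℂ] L2 n :=
  ∑ j, (θ j : ℂ) • mulBessel (h.posFun j)

lemma besselL2_comp_posBessel {η : Rn n → ℂ} (h : IsCutoff η) (θ : Rn n) :
    besselL2 n ∘L posBessel h θ = posL2 h θ ∘L besselL2 n := by
  simp only [posBessel, posL2, ContinuousLinearMap.comp_finsetSum, ContinuousLinearMap.finsetSum_comp,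
    ContinuousLinearMap.comp_smul, ContinuousLinearMap.smul_comp, besselL2_comp_mulBessel]

lemma posL2_eq_mulHom {η : Rn n → ℂ} (h : IsCutoff η) (z : ℂ) (θ : Rn n) :
    z • posL2 h θ = mulHom n (∑ j, (z * θ j : ℂ) • (h.posFun j).toBCF) := by
  rw [posL2, Finset.smul_sum, map_sum]
  refine Finset.sum_congr rfl fun j _ => ?_
  rw [smul_smul]
  exact mulOp_smul _ _ _ (.of_forall fun _ => rfl)

lemma exp_posL2_apply {η : Rn n → ℂ} (h : IsCutoff η) (z : ℂ) (θ : Rn n) (u : L2 n) :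
    NormedSpace.exp (z • posL2 h θ) u =ᵐ[volume] fun x =>
      Complex.exp (2 * Real.pi * Complex.I * z * (inner ℝ x θ : ℝ) * η x) * u x := by
  rw [posL2_eq_mulHom]
  filter_upwards [exp_mulHom_apply (∑ j, (z * θ j : ℂ) • (h.posFun j).toBCF) u] with x hx
  rw [hx]
  congr 2
  rw [BoundedContinuousFunction.sum_apply, PiLp.inner_apply]
  push_cast
  rw [Finset.mul_sum, Finset.sum_mul]
  refine Finset.sum_congr rfl fun j _ => ?_
  change (z * θ j : ℂ) * (2 * Real.pi * Complex.I * (x j : ℂ) * η x) = _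
  simp
  ring

/-- A function in `C₀^∞(ℝⁿ)` as an element of `L²(ℝⁿ)`. -/
def IsCutoff.toL2 {ρ : Rn n → ℂ} (h : IsCutoff ρ) : L2 n := (h.supp.toSchwartzMap h.smooth).toLp 2

lemma IsCutoff.coeFn_toL2 {ρ : Rn n → ℂ} (h : IsCutoff ρ) : h.toL2 =ᵐ[volume] ρ :=
  (h.supp.toSchwartzMap h.smooth).coeFn_toLp 2 volume

lemma IsCutoff.isPartial_toL2 {ρ : Rn n → ℂ} (h : IsCutoff ρ) (i : Fin n) :
    IsPartial i h.toL2 (h.partialDeriv i).toL2 := by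
  rw [isPartial_iff, Lp.toTemperedDistributionCLM_apply, Lp.toTemperedDistributionCLM_apply,
    IsCutoff.toL2, IsCutoff.toL2, Lp.toTemperedDistribution_toLp_eq,
    Lp.toTemperedDistribution_toLp_eq, TemperedDistribution.lineDerivOp_toTemperedDistributionCLM_eq]
  congr 1

/-- A function in `C₀^∞(ℝⁿ)` as an element of `H²(ℝⁿ)`. -/
def IsCutoff.toH2 {ρ : Rn n → ℂ} (h : IsCutoff ρ) : H2 n :=
  H2.lift (ContinuousLinearMap.toSpanSingleton ℂ h.toL2)
    (fun j => ContinuousLinearMap.toSpanSingleton ℂ (h.partialDeriv j).toL2)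
    (fun ij => ContinuousLinearMap.toSpanSingleton ℂ
      ((h.partialDeriv ij.2).partialDeriv ij.1).toL2)
    (fun j a => (h.isPartial_toL2 j).smul a)
    (fun i j a => ((h.partialDeriv j).isPartial_toL2 i).smul a) 1

lemma IsCutoff.incl_toH2 {ρ : Rn n → ℂ} (h : IsCutoff ρ) : H2.incl n h.toH2 = h.toL2 :=
  one_smul ℂ h.toL2

/-- The element `(1 - Δ) ρ` of `L²(ℝⁿ)`. -/
def IsCutoff.preBessel {ρ : Rn n → ℂ} (h : IsCutoff ρ) : L2 n := oneSubLap n h.toH2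

lemma IsCutoff.besselL2_preBessel {ρ : Rn n → ℂ} (h : IsCutoff ρ) :
    besselL2 n h.preBessel = h.toL2 := (besselL2_oneSubLap _).trans h.incl_toH2

/-- The rank one operators `f ↦ ⟨ρ e_{zθ}, f⟩ (1 - Δ)(ρ e_{zθ})` on `L²(ℝⁿ)`, where
`e_ξ(x) = exp (2 π i x · ξ)`, continued to complex `z` as an entire function. The exponentials are
those of the bounded operators of multiplication by `2 π i (x · θ) η(x)`, with `η = 1` on the support
of `ρ`. -/
def planeWave {ρ η : Rn n → ℂ} (hρ : IsCutoff ρ) (hη : IsCutoff η) (θ : Rn n) (z : ℂ) :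
    L2 n →L[ℂ] L2 n :=
  NormedSpace.exp (z • posBessel hη θ) ∘L
    ((innerSL ℂ hρ.toL2).smulRight hρ.preBessel ∘L NormedSpace.exp ((-z) • posL2 hη θ))

lemma continuous_planeWave {ρ η : Rn n → ℂ} (hρ : IsCutoff ρ) (hη : IsCutoff η) :
    Continuous fun p : Rn n × ℂ => planeWave hρ hη p.1 p.2 := by
  let _ := NormedAlgebra.restrictScalars ℚ ℂ (L2 n →L[ℂ] L2 n)
  have h1 : Continuous (posBessel hη) := by unfold posBessel; fun_prop
  have h2 : Continuous (posL2 hη) := by unfold posL2; fun_prop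
  have h3 : Continuous fun p : Rn n × ℂ => NormedSpace.exp (p.2 • posBessel hη p.1) :=
    NormedSpace.exp_continuous.comp (continuous_snd.smul (h1.comp continuous_fst))
  have h4 : Continuous fun p : Rn n × ℂ => NormedSpace.exp ((-p.2) • posL2 hη p.1) :=
    NormedSpace.exp_continuous.comp (continuous_snd.neg.smul (h2.comp continuous_fst))
  exact h3.clm_comp (continuous_const.clm_comp h4)

lemma differentiable_planeWave {ρ η : Rn n → ℂ} (hρ : IsCutoff ρ) (hη : IsCutoff η) (θ : Rn n) :
    Differentiable ℂ (planeWave hρ hη θ) := by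
  have h1 : Differentiable ℂ fun z : ℂ => NormedSpace.exp (z • posBessel hη θ) := fun z =>
    (hasDerivAt_exp_smul_const (𝔸 := L2 n →L[ℂ] L2 n) _ z).differentiableAt
  have h2 : Differentiable ℂ fun z : ℂ => NormedSpace.exp ((-z) • posL2 hη θ) := by
    have : Differentiable ℂ fun z : ℂ => NormedSpace.exp (z • posL2 hη θ) := fun z =>
      (hasDerivAt_exp_smul_const (𝔸 := L2 n →L[ℂ] L2 n) _ z).differentiableAt
    exact this.comp differentiable_neg
  exact h1.clm_comp ((differentiable_const _).clm_comp h2)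

lemma planeWave_smul {ρ η : Rn n → ℂ} (hρ : IsCutoff ρ) (hη : IsCutoff η) (r : ℝ) (θ : Rn n) :
    planeWave hρ hη (r • θ) 1 = planeWave hρ hη θ r := by
  have h1 : posBessel hη (r • θ) = (r : ℂ) • posBessel hη θ := by
    simp only [posBessel, Finset.smul_sum, smul_smul, PiLp.smul_apply, smul_eq_mul, Complex.ofReal_mul]
  have h2 : posL2 hη (r • θ) = (r : ℂ) • posL2 hη θ := by
    simp only [posL2, Finset.smul_sum, smul_smul, PiLp.smul_apply, smul_eq_mul, Complex.ofReal_mul]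
  simp only [planeWave, h1, h2, one_smul, neg_smul]

lemma integrable_mulOp {ρ : Rn n → ℂ} (hρ : IsCutoff ρ) (f : L2 n) :
    Integrable (mulOp ρ hρ.bdd f : Rn n → ℂ) := by
  refine (integrable_congr (coeFn_mulOp ρ hρ.bdd f)).2 ?_
  exact MemLp.integrable_mul (hρ.smooth.continuous.memLp_of_hasCompactSupport hρ.supp (p := 2))
    (Lp.memLp f)

lemma fourier_mulOp {ρ : Rn n → ℂ} (hρ : IsCutoff ρ) (f : L2 n) (ξ : Rn n) :
    𝓕 (mulOp ρ hρ.bdd f : Rn n → ℂ) ξ =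
      ∫ x, Complex.exp (-(2 * Real.pi * Complex.I * (inner ℝ x ξ : ℝ))) * (ρ x * f x) := by
  rw [Real.fourier_eq']
  apply integral_congr_ae
  filter_upwards [coeFn_mulOp ρ hρ.bdd f] with x hx
  rw [hx, smul_eq_mul]
  congr 2
  push_cast
  ring

/-- The matrix elements of a cut-off plane wave are products of Fourier transforms. -/
lemma inner_besselL2_planeWave {ρ η : Rn n → ℂ} (hρ : IsCutoff ρ) (hη : IsCutoff η)
    (hr : ∀ x, (ρ x).im = 0) (hηρ : ∀ x, ρ x ≠ 0 → η x = 1) (f g : L2 n) (ξ : Rn n) :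
    inner ℂ g (besselL2 n (planeWave hρ hη ξ 1 f)) =
      𝓕 (mulOp ρ hρ.bdd f : Rn n → ℂ) ξ *
        (starRingEnd ℂ) (𝓕 (mulOp ρ hρ.bdd g : Rn n → ℂ) ξ) := by
  have hconj : ∀ x, (starRingEnd ℂ) (ρ x) = ρ x := fun x => Complex.conj_eq_iff_im.2 (hr x)
  have hval : besselL2 n (planeWave hρ hη ξ 1 f) =
      inner ℂ hρ.toL2 (NormedSpace.exp ((-1 : ℂ) • posL2 hη ξ) f) •
        NormedSpace.exp ((1 : ℂ) • posL2 hη ξ) hρ.toL2 := by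
    have h1 : (1 : ℂ) • posL2 hη ξ ∘L besselL2 n = posL2 hη ξ ∘L besselL2 n := one_smul _ _
    have h2 := comp_exp_of_intertwine (T := besselL2 n) (a := (1 : ℂ) • posL2 hη ξ)
      (b := (1 : ℂ) • posBessel hη ξ) (by rw [one_smul, one_smul, besselL2_comp_posBessel])
    have h3 := congr($h2 (inner ℂ hρ.toL2 (NormedSpace.exp ((-1 : ℂ) • posL2 hη ξ) f) • hρ.preBessel))
    refine h3.trans ?_
    rw [ContinuousLinearMap.comp_apply, map_smul, map_smul, hρ.besselL2_preBessel]
  have e1 : inner ℂ hρ.toL2 (NormedSpace.exp ((-1 : ℂ) • posL2 hη ξ) f) =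
      𝓕 (mulOp ρ hρ.bdd f : Rn n → ℂ) ξ := by
    rw [fourier_mulOp hρ, L2.inner_def]
    apply integral_congr_ae
    filter_upwards [hρ.coeFn_toL2, exp_posL2_apply hη (-1) ξ f] with x h1 h2
    rw [h1, h2, RCLike.inner_apply, hconj]
    by_cases h0 : ρ x = 0
    · simp [h0]
    · rw [hηρ x h0]
      have : 2 * Real.pi * Complex.I * -1 * ((inner ℝ x ξ : ℝ) : ℂ) * 1 =
        -(2 * Real.pi * Complex.I * (inner ℝ x ξ : ℝ)) := by ring
      rw [this]
      ring
  have e2 : inner ℂ g (NormedSpace.exp ((1 : ℂ) • posL2 hη ξ) hρ.toL2) =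
      (starRingEnd ℂ) (𝓕 (mulOp ρ hρ.bdd g : Rn n → ℂ) ξ) := by
    rw [fourier_mulOp hρ, L2.inner_def, ← integral_conj]
    apply integral_congr_ae
    filter_upwards [hρ.coeFn_toL2, exp_posL2_apply hη 1 ξ hρ.toL2] with x h1 h2
    rw [h2, h1, RCLike.inner_apply, map_mul, map_mul, hconj, ← Complex.exp_conj]
    by_cases h0 : ρ x = 0
    · simp [h0]
    · rw [hηρ x h0]
      have : (starRingEnd ℂ) (-(2 * Real.pi * Complex.I * (inner ℝ x ξ : ℝ))) =
        2 * Real.pi * Complex.I * 1 * ((inner ℝ x ξ : ℝ) : ℂ) * 1 := by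
        simp [Complex.conj_ofNat]
      rw [this]
      ring
  rw [hval, inner_smul_right, e1, e2]

-- only the lemmas above are used from here on, and unification should not unfold the exponentials
attribute [irreducible] planeWave

/-! ### The cut-off free resolvent -/

/-- The symbol `(4 π² |ξ|² - z)⁻¹` of `(-Δ - z)⁻¹`. -/
def resolvSymbol (z : ℂ) (ξ : Rn n) : ℂ := ((lapSymbol ξ : ℂ) - z)⁻¹

lemma offSpectrum.exists_le {z : ℂ} (hz : offSpectrum z) :
    ∃ d : ℝ, 0 < d ∧ ∀ ξ : Rn n, d ≤ ‖(lapSymbol ξ : ℂ) - z‖ := by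
  obtain ⟨d, hd, h⟩ := hz.bound
  exact ⟨d, hd, fun ξ => by simpa using h (lapSymbol ξ) 1 (lapSymbol_nonneg ξ) zero_le_one⟩

lemma offSpectrum.lapSymbol_sub_ne_zero {z : ℂ} (hz : offSpectrum z) (ξ : Rn n) :
    (lapSymbol ξ : ℂ) - z ≠ 0 := by
  obtain ⟨d, hd, h⟩ := hz.exists_le (n := n)
  exact norm_pos_iff.1 (hd.trans_le (h ξ))

lemma continuous_resolvSymbol {z : ℂ} (hz : offSpectrum z) :
    Continuous (resolvSymbol (n := n) z) :=
  ((Complex.continuous_ofReal.comp continuous_lapSymbol).sub continuous_const).inv₀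
    hz.lapSymbol_sub_ne_zero

lemma memLp_resolvSymbol {z : ℂ} (hz : offSpectrum z) :
    MemLp (resolvSymbol (n := n) z) ∞ volume := by
  obtain ⟨d, hd, h⟩ := hz.exists_le (n := n)
  refine memLp_top_of_continuous (continuous_resolvSymbol hz) (C := d⁻¹) fun ξ => ?_
  rw [resolvSymbol, norm_inv]
  exact inv_anti₀ hd (h ξ)

/-- The Fourier multiplier `(4 π² |ξ|² - z)⁻¹` is a left inverse of `-Δ - z`. -/
lemma fmul_resolvSymbol_apply {z : ℂ} (hz : offSpectrum z) (U : H2 n) :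
    fmul _ (memLp_resolvSymbol hz) (-lapOp n U - z • H2.incl n U) = H2.incl n U := by
  apply fmul_eq_of_ae
  have h0 : FT n (-lapOp n U - z • H2.incl n U) =
      -FT n (lapOp n U) - z • FT n (H2.incl n U) := by
    rw [map_sub, map_neg, map_smul]
  rw [h0]
  filter_upwards [coeFn_FT_lapOp U, Lp.coeFn_sub (-FT n (lapOp n U)) (z • FT n (H2.incl n U)),
    Lp.coeFn_neg (FT n (lapOp n U)), Lp.coeFn_smul z (FT n (H2.incl n U))] with ξ h1 h2 h3 h4
  rw [h2, Pi.sub_apply, h3, Pi.neg_apply, h4, Pi.smul_apply, h1, resolvSymbol, smul_eq_mul]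
  have a2 := hz.lapSymbol_sub_ne_zero ξ
  field_simp

/-! ### Low frequencies -/

/-- The average of `planeWave` over the sphere of radius `z`. -/
def sphereWave {ρ η : Rn n → ℂ} (hρ : IsCutoff ρ) (hη : IsCutoff η) (z : ℂ) : L2 n →L[ℂ] L2 n :=
  ∫ θ : Metric.sphere (0 : Rn n) 1, planeWave hρ hη θ z ∂(volume : Measure (Rn n)).toSphere

lemma differentiable_sphereIntegral {X : Type*} [NormedAddCommGroup X] [NormedSpace ℂ X]
    [CompleteSpace X] {F : Rn n → ℂ → X} (hc : Continuous fun p : Rn n × ℂ => F p.1 p.2)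
    (hd : ∀ θ, Differentiable ℂ (F θ)) :
    Differentiable ℂ fun z => ∫ θ : Metric.sphere (0 : Rn n) 1, F θ z
      ∂(volume : Measure (Rn n)).toSphere := by
  have h := differentiable_setIntegral_of_continuous (ν := (volume : Measure (Rn n)).toSphere)
    (F := fun (θ : Metric.sphere (0 : Rn n) 1) z => F θ z) isCompact_univ MeasurableSet.univ
    (hc.comp (by fun_prop : Continuous
      fun p : Metric.sphere (0 : Rn n) 1 × ℂ => ((p.1 : Rn n), p.2))) fun θ => hd θ
  simpa only [Measure.restrict_univ] using h

lemma two_pi_inv_im {lam : ℂ} (h : 0 < lam.im) : 0 < ((2 * Real.pi : ℂ)⁻¹ * lam).im := by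
  have : ((2 * Real.pi : ℂ)⁻¹ * lam) = ((2 * Real.pi)⁻¹ : ℝ) * lam := by push_cast; rfl
  rw [this, Complex.im_ofReal_mul]
  positivity

/-- The resolvent symbol integrated over `|ξ| < 1` against a function that is holomorphic along rays, in terms of
the continuation of the radial integral. -/
lemma radialCont_sphereIntegral (hn : 1 ≤ n) {X : Type*} [NormedAddCommGroup X] [NormedSpace ℂ X]
    [CompleteSpace X] {F : Rn n → ℂ → X} (hc : Continuous fun p : Rn n × ℂ => F p.1 p.2)
    (hd : ∀ θ, Differentiable ℂ (F θ)) (hF : ∀ (r : ℝ) θ, F (r • θ) 1 = F θ r)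
    {lam : ℂ} (h : 0 < lam.im) :
    (4 * Real.pi ^ 2 : ℂ)⁻¹ • radialCont (fun z => z ^ (n - 1) •
      ∫ θ : Metric.sphere (0 : Rn n) 1, F θ z ∂(volume : Measure (Rn n)).toSphere)
        ((2 * Real.pi : ℂ)⁻¹ * lam) =
      ∫ ξ in Metric.ball (0 : Rn n) 1, resolvSymbol (lam ^ 2) ξ • F ξ 1 := by
  have hz := offSpectrum_sq h
  have hc1 : Continuous fun ξ : Rn n => resolvSymbol (lam ^ 2) ξ • F ξ 1 :=
    (continuous_resolvSymbol hz).smul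
      (hc.comp (by fun_prop : Continuous fun ξ : Rn n => (ξ, (1 : ℂ))))
  have hd1 : Differentiable ℂ fun z : ℂ => z ^ (n - 1) •
      ∫ θ : Metric.sphere (0 : Rn n) 1, F θ z ∂(volume : Measure (Rn n)).toSphere :=
    (differentiable_id.pow _).smul (differentiable_sphereIntegral hc hd)
  rw [setIntegral_ball_eq_polar hn hc1, radialCont_eq_integral hd1 (two_pi_inv_im h),
    ← intervalIntegral.integral_smul]
  refine intervalIntegral.integral_congr fun r _ => ?_
  have e1 : ∀ θ : Metric.sphere (0 : Rn n) 1,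
      resolvSymbol (lam ^ 2) (r • (θ : Rn n)) • F (r • (θ : Rn n)) 1 =
        ((4 * Real.pi ^ 2 : ℂ)⁻¹ * ((r : ℂ) ^ 2 - ((2 * Real.pi : ℂ)⁻¹ * lam) ^ 2)⁻¹) •
          F θ r := by
    intro θ
    rw [hF, resolvSymbol, lapSymbol, norm_smul, norm_eq_of_mem_sphere, mul_one, ← mul_inv]
    congr 2
    have : (Real.pi : ℂ) ≠ 0 := by exact_mod_cast Real.pi_ne_zero
    rw [Real.norm_eq_abs, sq_abs]
    push_cast
    field_simp
    ring
  simp only [e1]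
  rw [integral_smul]
  simp only [smul_smul]
  congr 1
  ring

lemma differentiable_sphereWave {ρ η : Rn n → ℂ} (hρ : IsCutoff ρ) (hη : IsCutoff η) :
    Differentiable ℂ (sphereWave hρ hη) :=
  differentiable_sphereIntegral (continuous_planeWave hρ hη) (differentiable_planeWave hρ hη)

/-- The continuation of the part of the cut-off free resolvent from frequencies `|ξ| < 1`. -/
def lowPart {ρ η : Rn n → ℂ} (hρ : IsCutoff ρ) (hη : IsCutoff η) (lam : ℂ) : L2 n →L[ℂ] L2 n :=
  (4 * Real.pi ^ 2 : ℂ)⁻¹ •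
    radialCont (fun z => z ^ (n - 1) • sphereWave hρ hη z) ((2 * Real.pi : ℂ)⁻¹ * lam)

lemma lowPart_eq_integral (hn : 1 ≤ n) {ρ η : Rn n → ℂ} (hρ : IsCutoff ρ) (hη : IsCutoff η)
    {lam : ℂ} (h : 0 < lam.im) :
    lowPart hρ hη lam = ∫ ξ in Metric.ball (0 : Rn n) 1,
      resolvSymbol (lam ^ 2) ξ • planeWave hρ hη ξ 1 :=
  radialCont_sphereIntegral hn (continuous_planeWave hρ hη) (differentiable_planeWave hρ hη)
    (planeWave_smul hρ hη) h

/-- The symbol of the part of the free resolvent from frequencies `|ξ| < 1`. -/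
def lowSymbol (z : ℂ) : Rn n → ℂ := (Metric.ball (0 : Rn n) 1).indicator (resolvSymbol z)

lemma memLp_lowSymbol {z : ℂ} (hz : offSpectrum z) : MemLp (lowSymbol (n := n) z) ∞ volume :=
  (memLp_resolvSymbol hz).indicator Metric.isOpen_ball.measurableSet

/-- Matrix elements are continuous linear in the operator, so they commute with integrals. -/
lemma exists_matrixElement_clm {X Y : Type*} [NormedAddCommGroup X] [InnerProductSpace ℂ X]
    [NormedAddCommGroup Y] [InnerProductSpace ℂ Y] (S : X →L[ℂ] Y) (f : X) (g : Y) :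
    ∃ Λ : (X →L[ℂ] X) →L[ℂ] ℂ, ∀ T, Λ T = inner ℂ g (S (T f)) :=
  ⟨(innerSL ℂ g ∘L S) ∘L ContinuousLinearMap.apply ℂ X f, fun _ => rfl⟩

/-- In the upper half-plane `lowPart` is the low-frequency part of the cut-off free resolvent. -/
lemma besselL2_comp_lowPart (hn : 1 ≤ n) {ρ η : Rn n → ℂ} (hρ : IsCutoff ρ) (hη : IsCutoff η)
    (hr : ∀ x, (ρ x).im = 0) (hηρ : ∀ x, ρ x ≠ 0 → η x = 1) {lam : ℂ} (h : 0 < lam.im) :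
    besselL2 n ∘L lowPart hρ hη lam =
      mulOp ρ hρ.bdd ∘L fmul _ (memLp_lowSymbol (offSpectrum_sq h)) ∘L mulOp ρ hρ.bdd := by
  have hz := offSpectrum_sq h
  have hc : Continuous fun ξ : Rn n => resolvSymbol (lam ^ 2) ξ • planeWave hρ hη ξ 1 :=
    (continuous_resolvSymbol hz).smul
      ((continuous_planeWave hρ hη).comp (by fun_prop : Continuous fun ξ : Rn n => (ξ, (1 : ℂ))))
  have hint : Integrable (fun ξ : Rn n => resolvSymbol (lam ^ 2) ξ • planeWave hρ hη ξ 1)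
      (volume.restrict (Metric.ball (0 : Rn n) 1)) :=
    (hc.continuousOn.integrableOn_compact (isCompact_closedBall _ _)).mono_set
      Metric.ball_subset_closedBall
  ext1 f
  refine ext_inner_left ℂ fun g => ?_
  obtain ⟨Λ, hΛ⟩ := exists_matrixElement_clm (besselL2 n) f g
  rw [ContinuousLinearMap.comp_apply, ← hΛ, lowPart_eq_integral hn hρ hη h, ← Λ.integral_comp_comm hint]
  have e2 : ∀ ξ, Λ (resolvSymbol (lam ^ 2) ξ • planeWave hρ hη ξ 1) = resolvSymbol (lam ^ 2) ξ *
      (𝓕 (mulOp ρ hρ.bdd f : Rn n → ℂ) ξ *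
        (starRingEnd ℂ) (𝓕 (mulOp ρ hρ.bdd g : Rn n → ℂ) ξ)) := by
    intro ξ
    rw [map_smul, smul_eq_mul, hΛ, inner_besselL2_planeWave hρ hη hr hηρ f g ξ]
  simp only [e2]
  have e3 : inner ℂ g ((mulOp ρ hρ.bdd ∘L fmul _ (memLp_lowSymbol hz) ∘L mulOp ρ hρ.bdd) f) =
      inner ℂ (FT n (mulOp ρ hρ.bdd g))
        (FT n (fmul _ (memLp_lowSymbol hz) (mulOp ρ hρ.bdd f))) := by
    rw [(FT n).inner_map_map, inner_mulOp_left hρ.bdd (.of_forall hr),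
      ContinuousLinearMap.comp_apply, ContinuousLinearMap.comp_apply]
  rw [e3, L2.inner_def, ← integral_indicator Metric.isOpen_ball.measurableSet]
  apply integral_congr_ae
  filter_upwards [FT_eq_fourierIntegral (integrable_mulOp hρ f),
    FT_eq_fourierIntegral (integrable_mulOp hρ g),
    coeFn_FT_fmul _ (memLp_lowSymbol hz) (mulOp ρ hρ.bdd f)] with ξ h1 h2 h3
  rw [h3, h2, h1, RCLike.inner_apply, lowSymbol]
  by_cases hξ : ξ ∈ Metric.ball (0 : Rn n) 1
  · rw [Set.indicator_of_mem hξ, Set.indicator_of_mem hξ, mul_assoc]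
  · rw [Set.indicator_of_notMem hξ, Set.indicator_of_notMem hξ, zero_mul, zero_mul]

/-! ### High frequencies -/

/-- The indicator of the frequencies `|ξ| ≥ 1`, divided by the symbol of `-Δ`. -/
def highSymbol : Rn n → ℂ := (Metric.ball (0 : Rn n) 1)ᶜ.indicator fun ξ => (lapSymbol ξ : ℂ)⁻¹

lemma lapSymbol_ge_four {ξ : Rn n} (h : ξ ∉ Metric.ball (0 : Rn n) 1) : 4 ≤ lapSymbol ξ := by
  have h1 : 1 ≤ ‖ξ‖ := by simpa using h
  have h2 : (1 : ℝ) ≤ Real.pi := by linarith [Real.pi_gt_three]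
  have h3 : 1 ≤ Real.pi ^ 2 := one_le_pow₀ h2
  have h4 : 1 ≤ ‖ξ‖ ^ 2 := one_le_pow₀ h1
  rw [lapSymbol]
  nlinarith

lemma measurable_lapSymbol_ofReal : Measurable fun ξ : Rn n => (lapSymbol ξ : ℂ) :=
  (Complex.continuous_ofReal.comp continuous_lapSymbol).measurable

lemma norm_highSymbol_le (ξ : Rn n) : ‖highSymbol ξ‖ ≤ 1 / 4 := by
  rw [highSymbol]
  by_cases h : ξ ∈ (Metric.ball (0 : Rn n) 1)ᶜ
  · have := lapSymbol_ge_four h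
    rw [Set.indicator_of_mem h, norm_inv, Complex.norm_real, Real.norm_of_nonneg (by linarith),
      one_div]
    exact inv_anti₀ (by norm_num) this
  · rw [Set.indicator_of_notMem h, norm_zero]; norm_num

lemma measurable_highSymbol : Measurable (highSymbol (n := n)) :=
  measurable_lapSymbol_ofReal.inv.indicator Metric.isOpen_ball.measurableSet.compl

lemma memLp_highSymbol : MemLp (highSymbol (n := n)) ∞ volume :=
  memLp_top_of_bound measurable_highSymbol.aestronglyMeasurable (1 / 4) (.of_forall norm_highSymbol_le)

lemma memLp_highSymbol' : MemLp (fun ξ : Rn n => (1 + lapSymbol ξ) * highSymbol ξ) ∞ volume := by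
  refine memLp_top_of_bound ((measurable_const.add measurable_lapSymbol_ofReal).mul
    measurable_highSymbol).aestronglyMeasurable 2 (.of_forall fun ξ => ?_)
  rw [norm_mul, norm_one_add_lapSymbol, highSymbol]
  by_cases h : ξ ∈ (Metric.ball (0 : Rn n) 1)ᶜ
  · have := lapSymbol_ge_four h
    rw [Set.indicator_of_mem h, norm_inv, Complex.norm_real, Real.norm_of_nonneg (by linarith),
      ← div_eq_mul_inv, div_le_iff₀ (by linarith)]
    linarith
  · rw [Set.indicator_of_notMem h, norm_zero, mul_zero]; norm_num

/-- The part of the free resolvent from frequencies `|ξ| ≥ 1`, which is analytic near `0`. -/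
def highPart (n : ℕ) (lam : ℂ) : L2 n →L[ℂ] L2 n :=
  fmul _ memLp_highSymbol' ∘L Ring.inverse (1 - lam ^ 2 • fmul _ memLp_highSymbol)

lemma isUnit_one_sub_highSymbol {lam : ℂ} (h : ‖lam‖ ≤ 1) :
    IsUnit (1 - lam ^ 2 • fmul _ (memLp_highSymbol (n := n))) := by
  apply isUnit_one_sub_of_norm_lt_one
  have h1 := norm_fmul_le (memLp_highSymbol (n := n)) (by norm_num) (.of_forall norm_highSymbol_le)
  rw [norm_smul, norm_pow]
  have : ‖lam‖ ^ 2 ≤ 1 := pow_le_one₀ (norm_nonneg _) h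
  nlinarith [norm_nonneg (fmul _ (memLp_highSymbol (n := n)))]

lemma differentiableAt_highPart {lam : ℂ} (h : ‖lam‖ ≤ 1) : DifferentiableAt ℂ (highPart n) lam := by
  obtain ⟨u, hu⟩ := isUnit_one_sub_highSymbol (n := n) h
  have h1 : DifferentiableAt ℂ
      (fun lam : ℂ => 1 - lam ^ 2 • fmul _ (memLp_highSymbol (n := n))) lam := by fun_prop
  have h2 : DifferentiableAt ℂ (Ring.inverse : (L2 n →L[ℂ] L2 n) → _)
      (1 - lam ^ 2 • fmul _ (memLp_highSymbol (n := n))) := by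
    rw [← hu]; exact differentiableAt_inverse u.isUnit
  exact (differentiableAt_const _).clm_comp
    (DifferentiableAt.fun_comp' (g := (Ring.inverse : (L2 n →L[ℂ] L2 n) → _)) lam h2 h1)

lemma besselL2_comp_highPart {lam : ℂ} (h : 0 < lam.im) (h1 : ‖lam‖ ≤ 1) :
    besselL2 n ∘L highPart n lam + fmul _ (memLp_lowSymbol (offSpectrum_sq h)) =
      fmul _ (memLp_resolvSymbol (offSpectrum_sq h)) := by
  have hz := offSpectrum_sq h
  have hhi : MemLp ((Metric.ball (0 : Rn n) 1)ᶜ.indicator (resolvSymbol (lam ^ 2))) ∞ volume :=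
    (memLp_resolvSymbol hz).indicator Metric.isOpen_ball.measurableSet.compl
  set D := fmul _ (memLp_highSymbol (n := n)) with hD
  set Q := fmul _ hhi with hQ
  have e1 : besselL2 n ∘L fmul _ memLp_highSymbol' = D := by
    refine fmul_comp _ _ _ (.of_forall fun ξ => ?_)
    rw [besselSymbol, inv_mul_cancel_left₀ (one_add_lapSymbol_ne_zero ξ)]
  have hQD : MemLp (fun ξ : Rn n => (Metric.ball (0 : Rn n) 1)ᶜ.indicator
      (resolvSymbol (lam ^ 2)) ξ * highSymbol ξ) ∞ volume := memLp_highSymbol.mul hhi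
  have hlQD : MemLp (fun ξ : Rn n => lam ^ 2 * ((Metric.ball (0 : Rn n) 1)ᶜ.indicator
      (resolvSymbol (lam ^ 2)) ξ * highSymbol ξ)) ∞ volume := hQD.const_mul _
  -- `1 / (p - λ²) · (1 - λ² / p) = 1 / p`
  have e2 : D = Q * (1 - lam ^ 2 • D) := by
    rw [mul_sub, mul_one, eq_sub_iff_add_eq, mul_smul_comm]
    have a1 : Q * D = fmul _ hQD := fmul_comp _ _ _ (.of_forall fun _ => rfl)
    rw [a1, fmul_smul _ _ hlQD (.of_forall fun _ => rfl)]
    refine fmul_add _ _ _ (.of_forall fun ξ => ?_)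
    rw [highSymbol]
    by_cases hξ : ξ ∈ (Metric.ball (0 : Rn n) 1)ᶜ
    · rw [Set.indicator_of_mem hξ, Set.indicator_of_mem hξ, resolvSymbol]
      have b1 := hz.lapSymbol_sub_ne_zero ξ
      have b2 : (lapSymbol ξ : ℂ) ≠ 0 := by
        have := lapSymbol_ge_four hξ
        exact_mod_cast (by positivity : lapSymbol ξ ≠ 0)
      field_simp
      ring
    · simp [Set.indicator_of_notMem hξ]
  have e3 : besselL2 n ∘L highPart n lam = Q := by
    rw [highPart, ← ContinuousLinearMap.comp_assoc, e1]
    change D * Ring.inverse (1 - lam ^ 2 • D) = Q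
    nth_rw 1 [e2]
    exact Ring.mul_inverse_cancel_right _ _ (isUnit_one_sub_highSymbol h1)
  rw [e3]
  refine fmul_add _ _ _ (.of_forall fun ξ => ?_)
  rw [lowSymbol, Set.indicator_compl_add_self_apply]

/-! ### Continuation of the cut-off free resolvent -/

lemma exists_cutoff {K : Set (Rn n)} (hK : IsCompact K) :
    ∃ η : Rn n → ℂ, IsCutoff η ∧ (∀ x, (η x).im = 0) ∧ ∀ x ∈ K, η x = 1 := by
  obtain ⟨R, hR⟩ := hK.isBounded.subset_closedBall (0 : Rn n)
  let b : ContDiffBump (0 : Rn n) :=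
    { rIn := max R 1
      rOut := max R 1 + 1
      rIn_pos := by positivity
      rIn_lt_rOut := by linarith }
  refine ⟨fun x => (b x : ℂ), ⟨Complex.ofRealCLM.contDiff.comp b.contDiff,
    b.hasCompactSupport.comp_left (g := Complex.ofReal) rfl⟩, fun x => Complex.ofReal_im _, fun x hx => ?_⟩
  have : x ∈ Metric.closedBall (0 : Rn n) b.rIn :=
    Metric.closedBall_subset_closedBall (le_max_left _ _) (hR hx)
  exact (congrArg Complex.ofReal (b.one_of_mem_closedBall this)).trans Complex.ofReal_one

lemma norm_log_scaled_le {lam : ℂ} (h : lam ∉ negImagAxis) :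
    ‖Complex.log (-Complex.I * ((2 * Real.pi : ℂ)⁻¹ * lam))‖ ≤
      ‖slitLog lam‖ + (|Real.log (2 * Real.pi)⁻¹| + Real.pi / 2) := by
  have e1 : -Complex.I * ((2 * Real.pi : ℂ)⁻¹ * lam) =
      ((2 * Real.pi)⁻¹ : ℝ) * (-Complex.I * lam) := by push_cast; ring
  have h0 : -Complex.I * lam ≠ 0 := Complex.slitPlane_ne_zero (neg_I_mul_mem_slitPlane h)
  have e2 : Complex.log (-Complex.I * lam) = slitLog lam - (Real.pi / 2 : ℝ) * Complex.I := by
    rw [slitLog]; ring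
  rw [e1, Complex.log_ofReal_mul (by positivity) h0, e2, add_comm, sub_add]
  refine (norm_sub_le _ _).trans ?_
  gcongr
  refine (norm_sub_le _ _).trans ?_
  rw [norm_mul, Complex.norm_real, Complex.norm_real, Complex.norm_I, mul_one, Real.norm_eq_abs,
    Real.norm_eq_abs, abs_of_pos (by positivity : 0 < Real.pi / 2), add_comm]

lemma two_pi_inv_norm_le (lam : ℂ) : ‖(2 * Real.pi : ℂ)⁻¹ * lam‖ ≤ ‖lam‖ / 2 := by
  have h2 : (1 : ℝ) ≤ Real.pi := by linarith [Real.pi_gt_three]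
  rw [norm_mul, norm_inv, norm_mul, Complex.norm_ofNat, Complex.norm_real,
    Real.norm_of_nonneg Real.pi_pos.le, inv_mul_eq_div]
  gcongr
  linarith

lemma two_pi_inv_notMem {lam : ℂ} (h : lam ∉ negImagAxis) :
    (2 * Real.pi : ℂ)⁻¹ * lam ∉ negImagAxis := by
  have e : (2 * Real.pi : ℂ)⁻¹ * lam = ((2 * Real.pi)⁻¹ : ℝ) * lam := by push_cast; rfl
  have hp : 0 < (2 * Real.pi)⁻¹ := by positivity
  rintro ⟨h1, h2⟩
  rw [e, Complex.re_ofReal_mul] at h1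
  rw [e, Complex.im_ofReal_mul] at h2
  exact h ⟨(mul_eq_zero.1 h1).resolve_left hp.ne', nonpos_of_mul_nonpos_right h2 hp⟩

/-- The continuation of the part of the cut-off free resolvent from frequencies `|ξ| ≥ 1`. -/
def cutHighPart {ρ : Rn n → ℂ} (hρ : IsCutoff ρ) (lam : ℂ) : L2 n →L[ℂ] L2 n :=
  mulBessel hρ ∘L highPart n lam ∘L mulOp ρ hρ.bdd

lemma differentiableAt_cutHighPart {ρ : Rn n → ℂ} (hρ : IsCutoff ρ) {lam : ℂ} (h : ‖lam‖ ≤ 1) :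
    DifferentiableAt ℂ (cutHighPart hρ) lam :=
  (differentiableAt_const (mulBessel hρ)).clm_comp
    ((differentiableAt_highPart h).clm_comp (differentiableAt_const (mulOp ρ hρ.bdd)))

lemma besselL2_comp_cutHighPart {ρ : Rn n → ℂ} (hρ : IsCutoff ρ) (lam : ℂ) :
    besselL2 n ∘L cutHighPart hρ lam =
      mulOp ρ hρ.bdd ∘L (besselL2 n ∘L highPart n lam) ∘L mulOp ρ hρ.bdd := by
  rw [cutHighPart, ← ContinuousLinearMap.comp_assoc, besselL2_comp_mulBessel,
    ContinuousLinearMap.comp_assoc, ContinuousLinearMap.comp_assoc]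

lemma analyticOnNhd_lowPart {ρ η : Rn n → ℂ} (hρ : IsCutoff ρ) (hη : IsCutoff η) :
    AnalyticOnNhd ℂ (lowPart hρ hη) (Metric.ball 0 1 \ negImagAxis) := by
  have h0 : Differentiable ℂ fun z : ℂ => z ^ (n - 1) • sphereWave hρ hη z :=
    (differentiable_id.pow (n - 1)).smul (differentiable_sphereWave hρ hη)
  have h1 := analyticOnNhd_radialCont h0
  have h2 : AnalyticOnNhd ℂ (fun lam : ℂ => (2 * Real.pi : ℂ)⁻¹ * lam)
      (Metric.ball 0 1 \ negImagAxis) := fun lam _ => by fun_prop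
  refine AnalyticOnNhd.smul analyticOnNhd_const (h1.comp h2 fun lam hlam => ?_)
  have h3 : ‖lam‖ < 1 := by simpa using hlam.1
  refine ⟨?_, two_pi_inv_notMem hlam.2⟩
  have := two_pi_inv_norm_le lam
  rw [mem_ball_zero_iff]
  linarith [norm_nonneg lam]

lemma norm_lowPart_le (hn : 2 ≤ n) {ρ η : Rn n → ℂ} (hρ : IsCutoff ρ) (hη : IsCutoff η) :
    ∃ C : ℝ, 0 < C ∧ ∀ lam ∈ Metric.ball (0 : ℂ) 1 \ negImagAxis,
      ‖lowPart hρ hη lam‖ ≤ C * (1 + ‖lam‖ ^ (n - 2) * ‖slitLog lam‖) := by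
  obtain ⟨C2, hC2, hlow⟩ := norm_radialCont_le (differentiable_sphereWave hρ hη) hn
  set c0 := |Real.log (2 * Real.pi)⁻¹| + Real.pi / 2 with hc0
  have hc0p : 0 ≤ c0 := by positivity
  set a := ‖(4 * Real.pi ^ 2 : ℂ)⁻¹‖
  refine ⟨a * C2 * (1 + c0) + 1, by positivity, fun lam hlam => ?_⟩
  have h1 : ‖lam‖ < 1 := by simpa using hlam.1
  have hμ := two_pi_inv_norm_le lam
  have h2 := hlow _ (hμ.trans (by linarith)) (two_pi_inv_notMem hlam.2)
  set s := ‖slitLog lam‖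
  set p := ‖lam‖ ^ (n - 2)
  have hp0 : 0 ≤ p := by positivity
  have hp1 : p ≤ 1 := pow_le_one₀ (norm_nonneg _) h1.le
  have hs0 : 0 ≤ s := norm_nonneg _
  have h3 : ‖(2 * Real.pi : ℂ)⁻¹ * lam‖ ^ (n - 2) ≤ p :=
    pow_le_pow_left₀ (norm_nonneg _) (hμ.trans (by linarith [norm_nonneg lam])) _
  have h4 := norm_log_scaled_le hlam.2
  have hps : 0 ≤ p * s := by positivity
  have h7 : 1 + p * (s + c0) ≤ (1 + c0) * (1 + p * s) := by nlinarith
  calc ‖lowPart hρ hη lam‖ ≤ a * (C2 * (1 + p * (s + c0))) := by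
        rw [lowPart, norm_smul]
        refine mul_le_mul_of_nonneg_left (h2.trans ?_) (norm_nonneg _)
        gcongr
    _ ≤ a * (C2 * ((1 + c0) * (1 + p * s))) := by gcongr
    _ = (a * C2 * (1 + c0)) * (1 + p * s) := by ring
    _ ≤ _ := by gcongr; linarith

/-- The free resolvent, cut off on both sides, continues analytically to a slit neighbourhood of the
origin as an operator `(1 - Δ)⁻¹ E` from `L²(ℝⁿ)` to `H²(ℝⁿ)`, with at most a logarithmic
singularity. -/
theorem exists_freeResolv_continuation (hn : 2 ≤ n) {ρ : Rn n → ℂ} (hρ : IsCutoff ρ)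
    (hr : ∀ x, (ρ x).im = 0) :
    ∃ E : ℂ → (L2 n →L[ℂ] L2 n),
      AnalyticOnNhd ℂ E (Metric.ball 0 1 \ negImagAxis) ∧
      (∀ (lam : ℂ) (h : 0 < lam.im), ‖lam‖ < 1 → besselL2 n ∘L E lam =
        mulOp ρ hρ.bdd ∘L fmul _ (memLp_resolvSymbol (offSpectrum_sq h)) ∘L mulOp ρ hρ.bdd) ∧
      ∃ C : ℝ, 0 < C ∧ ∀ lam ∈ Metric.ball (0 : ℂ) 1 \ negImagAxis,
        ‖besselL2 n ∘L E lam‖ ≤ C * (1 + ‖lam‖ ^ (n - 2) * ‖slitLog lam‖) := by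
  obtain ⟨η, hη, -, hη1⟩ := exists_cutoff hρ.supp.isCompact
  have hηρ : ∀ x, ρ x ≠ 0 → η x = 1 := fun x hx => hη1 x (subset_tsupport ρ hx)
  refine ⟨fun lam => cutHighPart hρ lam + lowPart hρ hη lam, ?_, ?_, ?_⟩
  · refine AnalyticOnNhd.add ?_ (analyticOnNhd_lowPart hρ hη)
    refine DifferentiableOn.analyticOnNhd (fun lam hlam => ?_)
      (Metric.isOpen_ball.sdiff isClosed_negImagAxis)
    have : ‖lam‖ < 1 := by simpa using hlam.1
    exact (differentiableAt_cutHighPart hρ this.le).differentiableWithinAt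
  · intro lam h h1
    rw [ContinuousLinearMap.comp_add, besselL2_comp_cutHighPart,
      besselL2_comp_lowPart (by omega) hρ hη hr hηρ h,
      ← besselL2_comp_highPart h h1.le, ContinuousLinearMap.add_comp, ContinuousLinearMap.comp_add]
  · have hcont : ContinuousOn (cutHighPart hρ) (Metric.closedBall 0 1) := fun lam hlam =>
      (differentiableAt_cutHighPart hρ (by simpa using hlam)).continuousAt.continuousWithinAt
    obtain ⟨C1, hC1⟩ := (isCompact_closedBall (0 : ℂ) 1).exists_bound_of_continuousOn hcont
    obtain ⟨C2, hC2, hlow⟩ := norm_lowPart_le hn hρ hη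
    have hC10 : 0 ≤ C1 := (norm_nonneg _).trans (hC1 0 (by simp))
    refine ⟨‖besselL2 n‖ * (C1 + C2) + 1, by positivity, fun lam hlam => ?_⟩
    have h1 : ‖lam‖ < 1 := by simpa using hlam.1
    have h5 := hlow lam hlam
    have h6 : ‖cutHighPart hρ lam‖ ≤ C1 := hC1 lam (by simpa using h1.le)
    set t := ‖lam‖ ^ (n - 2) * ‖slitLog lam‖
    have ht : 0 ≤ t := by positivity
    calc ‖besselL2 n ∘L (cutHighPart hρ lam + lowPart hρ hη lam)‖
        ≤ ‖besselL2 n‖ * (‖cutHighPart hρ lam‖ + ‖lowPart hρ hη lam‖) :=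
          (ContinuousLinearMap.opNorm_comp_le _ _).trans (by gcongr; exact norm_add_le _ _)
      _ ≤ ‖besselL2 n‖ * (C1 * (1 + t) + C2 * (1 + t)) := by
          have : C1 ≤ C1 * (1 + t) := le_mul_of_one_le_right hC10 (by linarith)
          gcongr
          exact h6.trans this
      _ = (‖besselL2 n‖ * (C1 + C2)) * (1 + t) := by ring
      _ ≤ _ := by gcongr; linarith

/-! ### The weight of a wavespeed -/

/-- The weight `c⁻²`, as a complex function. -/
def invSq (c : Rn n → ℝ) (x : Rn n) : ℂ := (((c x)⁻¹ * (c x)⁻¹ : ℝ) : ℂ)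

lemma IsWavespeed.memLp_invSq {c : Rn n → ℝ} (hc : IsWavespeed c) : MemLp (invSq c) ∞ volume :=
  (hc.inv_bdd.mul hc.inv_bdd : MemLp (fun x => (c x)⁻¹ * (c x)⁻¹) ∞ volume).ofReal (K := ℂ)

lemma IsWavespeed.posWeight {c : Rn n → ℝ} (hc : IsWavespeed c) : PosWeight (invSq c) := by
  refine ⟨.of_forall fun x => Complex.ofReal_im _, ?_⟩
  set M := (eLpNorm c ∞ volume).toReal with hM
  have hb : ∀ᵐ x, ‖c x‖ ≤ M := by
    filter_upwards [enorm_ae_le_eLpNormEssSup c volume] with x hx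
    rw [hM, eLpNorm_exponent_top, ← toReal_enorm]
    exact ENNReal.toReal_mono (by simpa using hc.bdd.eLpNorm_ne_top) hx
  have hM0 : 0 ≤ M := ENNReal.toReal_nonneg
  refine ⟨(M + 1)⁻¹ * (M + 1)⁻¹, by positivity, ?_⟩
  filter_upwards [hb, hc.pos] with x h1 h2
  rw [Real.norm_of_nonneg h2.le] at h1
  have : (M + 1)⁻¹ ≤ (c x)⁻¹ := inv_anti₀ h2 (by linarith)
  rw [invSq, Complex.ofReal_re]
  gcongr

lemma IsWavespeed.memLp_one_sub_invSq {c : Rn n → ℝ} (hc : IsWavespeed c) :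
    MemLp (fun x => 1 - invSq c x) ∞ volume :=
  (memLp_top_const (1 : ℂ)).sub hc.memLp_invSq

lemma IsWavespeed.sq_comp_invSq {c : Rn n → ℝ} (hc : IsWavespeed c) :
    mulOp _ hc.sq_bdd ∘L mulOp _ hc.memLp_invSq = 1 := by
  have h1 : MemLp (fun _ : Rn n => (1 : ℂ)) ∞ volume := memLp_top_const 1
  rw [mulOp_comp _ _ h1, mulOp_eq_one h1 (.of_forall fun _ => rfl)]
  filter_upwards [hc.pos] with x hx
  rw [invSq, ← Complex.ofReal_mul, ← Complex.ofReal_one, Complex.ofReal_inj]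
  field_simp

lemma IsWavespeed.invSq_comp_sq {c : Rn n → ℝ} (hc : IsWavespeed c) :
    mulOp _ hc.memLp_invSq ∘L mulOp _ hc.sq_bdd = 1 := by
  have h1 : MemLp (fun _ : Rn n => (1 : ℂ)) ∞ volume := memLp_top_const 1
  rw [mulOp_comp _ _ h1, mulOp_eq_one h1 (.of_forall fun _ => rfl)]
  filter_upwards [hc.pos] with x hx
  rw [invSq, ← Complex.ofReal_mul, ← Complex.ofReal_one, Complex.ofReal_inj]
  field_simp

/-! ### The resolvent of the perturbed operator -/

lemma shiftedOp_apply {c : Rn n → ℝ} (hc : IsWavespeed c) (lam : ℂ) (U : H2 n) :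
    shiftedOp c hc lam U = -mulOp _ hc.sq_bdd (lapOp n U) - lam ^ 2 • H2.incl n U := rfl

lemma hamOp_apply {w : Rn n → ℂ} (hw : MemLp w ∞ volume) (z : ℂ) (U : H2 n) :
    hamOp w hw z U = -lapOp n U - z • mulOp w hw (H2.incl n U) := rfl

/-- `L - λ² = c² (-Δ - λ² c⁻²)`. -/
lemma shiftedOp_eq {c : Rn n → ℝ} (hc : IsWavespeed c) (lam : ℂ) :
    shiftedOp c hc lam = mulOp _ hc.sq_bdd ∘L hamOp _ hc.memLp_invSq (lam ^ 2) := by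
  ext1 U
  have h : mulOp _ hc.sq_bdd (mulOp _ hc.memLp_invSq (H2.incl n U)) = H2.incl n U :=
    congr($hc.sq_comp_invSq (H2.incl n U))
  rw [ContinuousLinearMap.comp_apply, shiftedOp_apply, hamOp_apply, map_sub, map_neg, map_smul, h]

lemma invSq_comp_shiftedOp {c : Rn n → ℝ} (hc : IsWavespeed c) (lam : ℂ) (U : H2 n) :
    mulOp _ hc.memLp_invSq (shiftedOp c hc lam U) = hamOp _ hc.memLp_invSq (lam ^ 2) U := by
  rw [shiftedOp_eq]
  exact congr($hc.invSq_comp_sq (hamOp _ hc.memLp_invSq (lam ^ 2) U))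

theorem shiftedOp_isInvertible {c : Rn n → ℝ} (hc : IsWavespeed c) {lam : ℂ} (h : 0 < lam.im) :
    (shiftedOp c hc lam).IsInvertible := by
  rw [shiftedOp_eq]
  obtain ⟨e, he⟩ := hamOp_isInvertible hc.memLp_invSq hc.posWeight (offSpectrum_sq h)
  rw [← he]
  exact ⟨e.trans (ContinuousLinearEquiv.equivOfInverse' _ _ hc.sq_comp_invSq hc.invSq_comp_sq),
    rfl⟩

lemma shiftedOp_resolv {c : Rn n → ℝ} (hc : IsWavespeed c) {lam : ℂ} (h : 0 < lam.im) (f : L2 n) :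
    shiftedOp c hc lam (resolv c hc lam f) = f := by
  obtain ⟨e, he⟩ := shiftedOp_isInvertible hc h
  rw [resolv, ← he, ContinuousLinearMap.inverse_equiv]
  exact e.apply_symm_apply f

/-- The resolvent identity `R = R₀ (c⁻² - λ² (1 - c⁻²) R)`. -/
lemma incl_resolv_eq {c : Rn n → ℝ} (hc : IsWavespeed c) {lam : ℂ} (h : 0 < lam.im) (f : L2 n) :
    H2.incl n (resolv c hc lam f) = fmul _ (memLp_resolvSymbol (offSpectrum_sq h))
      (mulOp _ hc.memLp_invSq f -
        lam ^ 2 • mulOp _ hc.memLp_one_sub_invSq (H2.incl n (resolv c hc lam f))) := by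
  set U := resolv c hc lam f with hU
  have h1 : mulOp _ hc.memLp_invSq f = hamOp _ hc.memLp_invSq (lam ^ 2) U := by
    rw [← invSq_comp_shiftedOp hc, hU, shiftedOp_resolv hc h]
  have h2 : mulOp _ hc.memLp_one_sub_invSq (H2.incl n U) + mulOp _ hc.memLp_invSq (H2.incl n U) =
      H2.incl n U := by
    have h3 : MemLp (fun _ : Rn n => (1 : ℂ)) ∞ volume := memLp_top_const 1
    have h4 := mulOp_add hc.memLp_one_sub_invSq hc.memLp_invSq h3
      (.of_forall fun _ => (sub_add_cancel _ _).symm)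
    rw [mulOp_eq_one h3 (.of_forall fun _ => rfl)] at h4
    exact congr($h4 (H2.incl n U))
  rw [h1, hamOp_apply, sub_sub, ← smul_add, add_comm (mulOp _ hc.memLp_invSq _), h2]
  exact (fmul_resolvSymbol_apply (offSpectrum_sq h) U).symm

/-- The operator `L - λ²`, transported to `L²(ℝⁿ)` by the isomorphism `(1 - Δ)⁻¹`. -/
def shiftedBessel (c : Rn n → ℝ) (hc : IsWavespeed c) (lam : ℂ) : L2 n →L[ℂ] L2 n :=
  shiftedOp c hc lam ∘L bessel n

lemma shiftedBessel_eq {c : Rn n → ℝ} (hc : IsWavespeed c) (lam : ℂ) :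
    shiftedBessel c hc lam = waveOp c hc ∘L bessel n - lam ^ 2 • besselL2 n := by
  rw [shiftedBessel, shiftedOp, ContinuousLinearMap.sub_comp, ContinuousLinearMap.smul_comp,
    incl_comp_bessel]

lemma isUnit_shiftedBessel {c : Rn n → ℝ} (hc : IsWavespeed c) {lam : ℂ} (h : 0 < lam.im) :
    IsUnit (shiftedBessel c hc lam) := by
  obtain ⟨e, he⟩ := shiftedOp_isInvertible hc h
  refine ⟨ContinuousLinearEquiv.toUnit ((besselEquiv n).trans e), ?_⟩
  rw [shiftedBessel, ← he]
  rfl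

lemma bessel_inverse_shiftedBessel {c : Rn n → ℝ} (hc : IsWavespeed c) {lam : ℂ} (h : 0 < lam.im)
    (f : L2 n) : bessel n (Ring.inverse (shiftedBessel c hc lam) f) = resolv c hc lam f := by
  have h1 : shiftedBessel c hc lam (Ring.inverse (shiftedBessel c hc lam) f) = f :=
    congr($(Ring.mul_inverse_cancel _ (isUnit_shiftedBessel hc h)) f)
  have h2 : shiftedOp c hc lam (bessel n (Ring.inverse (shiftedBessel c hc lam) f)) =
      shiftedOp c hc lam (resolv c hc lam f) := h1.trans (shiftedOp_resolv hc h f).symm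
  obtain ⟨e, he⟩ := shiftedOp_isInvertible hc h
  rw [← he] at h2
  exact e.injective h2

lemma analyticAt_inverse_shiftedBessel {c : Rn n → ℝ} (hc : IsWavespeed c) {lam : ℂ}
    (h : 0 < lam.im) : AnalyticAt ℂ (fun z => Ring.inverse (shiftedBessel c hc z)) lam := by
  obtain ⟨u, hu⟩ := isUnit_shiftedBessel hc h
  have h1 : AnalyticAt ℂ (shiftedBessel c hc) lam := by
    rw [funext (shiftedBessel_eq hc)]
    exact analyticAt_const.sub ((analyticAt_id.pow 2).smul analyticAt_const)
  have h2 : AnalyticAt ℂ (Ring.inverse : (L2 n →L[ℂ] L2 n) → _) (shiftedBessel c hc lam) := by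
    rw [← hu]; exact analyticAt_inverse u
  exact h2.comp h1

/-! ### Perturbation at low energy -/

/-- The fixed point equation `T = B (Y - λ² V T)`, with `B` analytic and `λ² B V` small, has a
unique solution, which is analytic. -/
lemma exists_analytic_fixedPoint {𝔸 : Type*} [NormedRing 𝔸] [NormedAlgebra ℂ 𝔸] [CompleteSpace 𝔸]
    {U : Set ℂ} {B : ℂ → 𝔸} (hB : AnalyticOnNhd ℂ B U) (V Y : 𝔸)
    (hs : ∀ lam ∈ U, ‖lam ^ 2 • (B lam * V)‖ ≤ 1 / 2) :
    ∃ A : ℂ → 𝔸, AnalyticOnNhd ℂ A U ∧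
      (∀ lam ∈ U, ∀ T, T = B lam * (Y - lam ^ 2 • (V * T)) ↔ T = A lam) ∧
      ∀ lam ∈ U, ‖A lam‖ ≤ 2 * (‖B lam‖ * ‖Y‖) := by
  have hu : ∀ lam ∈ U, IsUnit (1 + lam ^ 2 • (B lam * V)) := fun lam h => by
    rw [← sub_neg_eq_add]
    exact isUnit_one_sub_of_norm_lt_one (by rw [norm_neg]; linarith [hs lam h])
  have key : ∀ lam ∈ U, ∀ T, T = B lam * (Y - lam ^ 2 • (V * T)) ↔
      T = Ring.inverse (1 + lam ^ 2 • (B lam * V)) * (B lam * Y) := fun lam h T => by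
    obtain ⟨u, hu⟩ := hu lam h
    rw [← hu, Ring.inverse_unit, Units.eq_inv_mul_iff_mul_eq, hu, add_mul, one_mul, smul_mul_assoc,
      mul_sub, mul_smul_comm, mul_assoc, eq_sub_iff_add_eq]
  refine ⟨_, fun lam h => ?_, key, fun lam h => ?_⟩
  · obtain ⟨u, hu⟩ := hu lam h
    have h1 : AnalyticAt ℂ (fun lam => 1 + lam ^ 2 • (B lam * V)) lam :=
      analyticAt_const.add ((analyticAt_id.pow 2).smul ((hB lam h).mul analyticAt_const))
    have h2 : AnalyticAt ℂ (Ring.inverse : 𝔸 → 𝔸) (1 + lam ^ 2 • (B lam * V)) := by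
      rw [← hu]; exact analyticAt_inverse u
    exact AnalyticAt.mul (AnalyticAt.comp (g := Ring.inverse) h2 h1)
      ((hB lam h).mul analyticAt_const)
  · set T := Ring.inverse (1 + lam ^ 2 • (B lam * V)) * (B lam * Y) with hT
    have h1 := (key lam h T).2 rfl
    rw [mul_sub, mul_smul_comm, ← mul_assoc, ← smul_mul_assoc] at h1
    have h2 : ‖T‖ ≤ ‖B lam‖ * ‖Y‖ + 1 / 2 * ‖T‖ :=
      calc ‖T‖ = ‖B lam * Y - lam ^ 2 • (B lam * V) * T‖ := congrArg norm h1
        _ ≤ ‖B lam * Y‖ + ‖lam ^ 2 • (B lam * V) * T‖ := norm_sub_le _ _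
        _ ≤ _ := add_le_add (norm_mul_le _ _) ((norm_mul_le _ _).trans
          (mul_le_mul_of_nonneg_right (hs lam h) (norm_nonneg _)))
    linarith

lemma norm_slitLog_le {lam : ℂ} : ‖slitLog lam‖ ≤ |Real.log ‖lam‖| + 2 * Real.pi := by
  have h1 : ‖Complex.log (-Complex.I * lam)‖ ≤ |Real.log ‖lam‖| + Real.pi := by
    refine (Complex.norm_le_abs_re_add_abs_im _).trans ?_
    rw [Complex.log_re, Complex.log_im, norm_mul, norm_neg, Complex.norm_I, one_mul]
    gcongr
    exact Complex.abs_arg_le_pi _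
  refine (norm_add_le _ _).trans ?_
  rw [norm_mul, Complex.norm_real, Complex.norm_I, mul_one,
    Real.norm_of_nonneg (by positivity)]
  linarith [Real.pi_pos]

lemma sq_mul_one_add_slitLog_le (m : ℕ) {lam : ℂ} (h0 : lam ≠ 0) (h1 : ‖lam‖ ≤ 1) :
    ‖lam‖ ^ 2 * (1 + ‖lam‖ ^ m * ‖slitLog lam‖) ≤ 10 * ‖lam‖ := by
  have hp : 0 < ‖lam‖ := norm_pos_iff.2 h0
  have h2 := (Real.abs_log_mul_self_lt ‖lam‖ hp h1).le
  rw [abs_mul, abs_norm] at h2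
  have h3 : ‖lam‖ ^ m * ‖slitLog lam‖ ≤ |Real.log ‖lam‖| + 2 * Real.pi :=
    (mul_le_of_le_one_left (norm_nonneg _) (pow_le_one₀ hp.le h1)).trans norm_slitLog_le
  have h4 := Real.pi_lt_four
  calc ‖lam‖ ^ 2 * (1 + ‖lam‖ ^ m * ‖slitLog lam‖)
      ≤ ‖lam‖ ^ 2 * (1 + (|Real.log ‖lam‖| + 2 * Real.pi)) := by gcongr
    _ = ‖lam‖ * (‖lam‖ * (1 + 2 * Real.pi) + |Real.log ‖lam‖| * ‖lam‖) := by ring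
    _ ≤ ‖lam‖ * (1 * (1 + 2 * Real.pi) + 1) := by gcongr
    _ ≤ _ := by nlinarith [Real.pi_lt_d2]

/-- The equation that determines the continuation of `ρ R(λ) χ`. -/
lemma cutoff_resolv_fixedPoint {c : Rn n → ℝ} (hc : IsWavespeed c) {χ ρ : Rn n → ℂ}
    (hχ : IsCutoff χ) (hρ : IsCutoff ρ) (hρc : ∀ᵐ x, ρ x * (1 - invSq c x) = 1 - invSq c x)
    (hρχ : ∀ x, ρ x * χ x = χ x) {lam : ℂ} (h : 0 < lam.im) :
    let B : L2 n →L[ℂ] L2 n :=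
      mulOp ρ hρ.bdd ∘L fmul _ (memLp_resolvSymbol (offSpectrum_sq h)) ∘L mulOp ρ hρ.bdd
    let T : L2 n →L[ℂ] L2 n := mulOp ρ hρ.bdd ∘L H2.incl n ∘L resolv c hc lam ∘L mulOp χ hχ.bdd
    T = B * (mulOp _ hc.memLp_invSq * mulOp χ hχ.bdd -
      lam ^ 2 • (mulOp _ hc.memLp_one_sub_invSq * T)) := by
  intro B T
  set P := mulOp ρ hρ.bdd with hP
  set X := mulOp χ hχ.bdd with hX
  set W := mulOp _ hc.memLp_invSq with hW
  set V := mulOp _ hc.memLp_one_sub_invSq with hV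
  set Q := fmul _ (memLp_resolvSymbol (n := n) (offSpectrum_sq h)) with hQ
  have hPV : P * V = V := mulOp_comp _ _ _ (hρc.mono fun x hx => hx.symm)
  have hVP : V * P = V := mulOp_comp _ _ _ (hρc.mono fun x hx => by rw [mul_comm]; exact hx.symm)
  have hWX : MemLp (fun x => invSq c x * χ x) ∞ volume := hχ.bdd.mul hc.memLp_invSq
  have hPWX : P * (W * X) = W * X := by
    have e : W * X = mulOp _ hWX := mulOp_comp _ _ _ (.of_forall fun _ => rfl)
    rw [e]
    exact mulOp_comp _ _ _ (.of_forall fun x => by rw [mul_left_comm, hρχ])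
  have h1 : ∀ f, P (W (X f)) = W (X f) := fun f => congr($hPWX f)
  have h2 : ∀ f, P (V f) = V f := fun f => congr($hPV f)
  have h3 : ∀ f, V (P f) = V f := fun f => congr($hVP f)
  ext1 f
  have hT : T f = P (H2.incl n (resolv c hc lam (X f))) := rfl
  have hr : (B * (W * X - lam ^ 2 • (V * T))) f = P (Q (P (W (X f) - lam ^ 2 • V (T f)))) := rfl
  rw [hr, hT, h3, map_sub P (W (X f)), map_smul P (lam ^ 2), h1, h2]
  exact congrArg P (incl_resolv_eq hc h (X f))

lemma mem_ball_of_mem_slitSquare {δ : ℝ} (hδ : 0 < δ) {lam : ℂ} (h : lam ∈ slitSquare (δ / 3)) :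
    lam ∈ Metric.ball (0 : ℂ) δ \ negImagAxis := by
  obtain ⟨⟨h1, h2⟩, h3⟩ := h
  refine ⟨?_, h3⟩
  rw [mem_ball_zero_iff]
  linarith [Complex.norm_le_abs_re_add_abs_im lam]

lemma isOpen_upperHalfPlane : IsOpen {lam : ℂ | 0 < lam.im} :=
  isOpen_lt continuous_const Complex.continuous_im

/-- The cut-off resolvent in the upper half-plane, transported to `L²(ℝⁿ)`. -/
lemma besselL2_mulBessel_inverse {c : Rn n → ℝ} (hc : IsWavespeed c) {χ : Rn n → ℂ}
    (hχ : IsCutoff χ) {lam : ℂ} (h : 0 < lam.im) :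
    besselL2 n ∘L (mulBessel hχ * Ring.inverse (shiftedBessel c hc lam) * mulOp χ hχ.bdd) =
      cutoffResolv c hc χ hχ lam := by
  ext1 f
  refine congr($(besselL2_comp_mulBessel hχ)
    (Ring.inverse (shiftedBessel c hc lam) (mulOp χ hχ.bdd f))).trans ?_
  refine congrArg (mulOp χ hχ.bdd) ?_
  refine (incl_bessel _).symm.trans ?_
  exact congrArg (H2.incl n) (bessel_inverse_shiftedBessel hc h (mulOp χ hχ.bdd f))

/-- The continuation of the cut-off resolvent, transported to `L²(ℝⁿ)`, in a slit disc. -/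
theorem exists_cutoffResolv_continuation (hn : 2 ≤ n) {c : Rn n → ℝ} (hc : IsWavespeed c)
    {χ : Rn n → ℂ} (hχ : IsCutoff χ) :
    ∃ δ : ℝ, 0 < δ ∧ δ < 1 ∧ ∃ G : ℂ → (L2 n →L[ℂ] L2 n),
      AnalyticOnNhd ℂ G (Metric.ball 0 δ \ negImagAxis) ∧
      (∀ lam : ℂ, 0 < lam.im → ‖lam‖ < δ →
        besselL2 n ∘L G lam = cutoffResolv c hc χ hχ lam) ∧
      ∃ C : ℝ, 0 < C ∧ ∀ lam ∈ Metric.ball (0 : ℂ) δ \ negImagAxis,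
        ‖besselL2 n ∘L G lam‖ ≤ C * (1 + ‖lam‖ ^ (n - 2) * ‖slitLog lam‖) := by
  obtain ⟨K, hK, hcK⟩ := hc.supp
  obtain ⟨ρ, hρ, hρr, hρ1⟩ := exists_cutoff (hK.union hχ.supp.isCompact)
  have hρc : ∀ᵐ x, ρ x * (1 - invSq c x) = 1 - invSq c x := by
    filter_upwards [hcK] with x hx
    by_cases h : x ∈ K
    · rw [hρ1 x (Or.inl h), one_mul]
    · simp [invSq, hx h]
  have hρχ : ∀ x, ρ x * χ x = χ x := fun x => by
    by_cases h : χ x = 0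
    · rw [h, mul_zero]
    · rw [hρ1 x (Or.inr (subset_tsupport χ h)), one_mul]
  have hχρ : mulOp χ hχ.bdd * mulOp ρ hρ.bdd = mulOp χ hχ.bdd :=
    mulOp_comp _ _ _ (.of_forall fun x => by rw [mul_comm, hρχ])
  obtain ⟨E, hE, hEq, C, hC, hbound⟩ := exists_freeResolv_continuation hn hρ hρr
  set B : ℂ → (L2 n →L[ℂ] L2 n) := fun lam => besselL2 n * E lam with hB
  set V := mulOp _ hc.memLp_one_sub_invSq with hV
  set Y := mulOp _ hc.memLp_invSq * mulOp χ hχ.bdd with hY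
  have hBbound : ∀ lam ∈ Metric.ball (0 : ℂ) 1 \ negImagAxis,
      ‖B lam‖ ≤ C * (1 + ‖lam‖ ^ (n - 2) * ‖slitLog lam‖) := hbound
  -- the radius makes `λ² B V` of norm at most `1 / 2`
  obtain ⟨δ, hδ0, hδ1, hδ⟩ : ∃ δ : ℝ, 0 < δ ∧ δ < 1 ∧ C * ‖V‖ * (10 * δ) ≤ 1 / 2 := by
    refine ⟨(20 * (C * ‖V‖ + 1))⁻¹, by positivity, inv_lt_one_of_one_lt₀ ?_, ?_⟩
    · nlinarith [mul_nonneg hC.le (norm_nonneg V)]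
    · rw [← mul_assoc, ← div_eq_mul_inv, div_le_iff₀ (by positivity)]
      linarith
  have hsub : Metric.ball (0 : ℂ) δ \ negImagAxis ⊆ Metric.ball 0 1 \ negImagAxis :=
    Set.sdiff_subset_sdiff_left (Metric.ball_subset_ball hδ1.le)
  have hs : ∀ lam ∈ Metric.ball (0 : ℂ) δ \ negImagAxis, ‖lam ^ 2 • (B lam * V)‖ ≤ 1 / 2 := by
    intro lam hlam
    have h1 : ‖lam‖ < δ := by simpa using hlam.1
    have h2 := hBbound lam (hsub hlam)
    have h3 := sq_mul_one_add_slitLog_le (n - 2) (ne_zero_of_notMem_negImagAxis hlam.2)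
      (h1.le.trans hδ1.le)
    set t := 1 + ‖lam‖ ^ (n - 2) * ‖slitLog lam‖
    calc ‖lam ^ 2 • (B lam * V)‖ ≤ ‖lam‖ ^ 2 * (C * t * ‖V‖) := by
          rw [norm_smul, norm_pow]
          gcongr
          exact (norm_mul_le _ _).trans (by gcongr)
      _ = C * ‖V‖ * (‖lam‖ ^ 2 * t) := by ring
      _ ≤ C * ‖V‖ * (10 * δ) := by
          refine mul_le_mul_of_nonneg_left (h3.trans ?_) (by positivity)
          linarith
      _ ≤ _ := hδ
  have hBa : AnalyticOnNhd ℂ B (Metric.ball 0 δ \ negImagAxis) :=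
    analyticOnNhd_const.mul (hE.mono hsub)
  obtain ⟨A, hA, hAfix, hAbound⟩ := exists_analytic_fixedPoint hBa V Y hs
  have key : ∀ lam ∈ Metric.ball (0 : ℂ) δ \ negImagAxis,
      besselL2 n ∘L (mulBessel hχ * E lam * (Y - lam ^ 2 • (V * A lam))) =
        mulOp χ hχ.bdd * A lam := by
    intro lam hlam
    have h1 := (hAfix lam hlam (A lam)).2 rfl
    have h2 : besselL2 n * mulBessel hχ = mulOp χ hχ.bdd * besselL2 n := besselL2_comp_mulBessel hχ
    change besselL2 n * (mulBessel hχ * E lam * (Y - lam ^ 2 • (V * A lam))) = _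
    rw [mul_assoc, ← mul_assoc, h2, mul_assoc, ← mul_assoc (besselL2 n)]
    exact congrArg (mulOp χ hχ.bdd * ·) h1.symm
  refine ⟨δ, hδ0, hδ1, fun lam => mulBessel hχ * E lam * (Y - lam ^ 2 • (V * A lam)), ?_, ?_,
    ‖mulOp χ hχ.bdd‖ * (2 * (C * ‖Y‖)) + 1, by positivity, ?_⟩
  · exact (analyticOnNhd_const.mul (hE.mono hsub)).mul (analyticOnNhd_const.sub
      ((analyticOnNhd_id.pow 2).smul (analyticOnNhd_const.mul hA)))
  · intro lam h hlt
    have hlam : lam ∈ Metric.ball (0 : ℂ) δ \ negImagAxis :=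
      ⟨by simpa using hlt, fun hm => absurd hm.2 (not_le.2 h)⟩
    have h1 := cutoff_resolv_fixedPoint hc hχ hρ hρc hρχ h
    have h2 : B lam = mulOp ρ hρ.bdd ∘L fmul _ (memLp_resolvSymbol (offSpectrum_sq h)) ∘L
        mulOp ρ hρ.bdd := hEq lam h (hlt.trans hδ1)
    simp only [← h2] at h1
    have h3 := (hAfix lam hlam _).1 h1
    rw [key lam hlam, ← h3]
    change (mulOp χ hχ.bdd * mulOp ρ hρ.bdd) ∘L _ = _
    rw [hχρ, cutoffResolv]
  · intro lam hlam
    rw [key lam hlam]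
    have h1 := hAbound lam hlam
    have h2 := hBbound lam (hsub hlam)
    set t := 1 + ‖lam‖ ^ (n - 2) * ‖slitLog lam‖
    have ht : 0 ≤ t := by positivity
    calc ‖mulOp χ hχ.bdd * A lam‖ ≤ ‖mulOp χ hχ.bdd‖ * (2 * (C * t * ‖Y‖)) :=
          (norm_mul_le _ _).trans (by gcongr; exact h1.trans (by gcongr))
      _ = ‖mulOp χ hχ.bdd‖ * (2 * (C * ‖Y‖)) * t := by ring
      _ ≤ _ := by gcongr; linarith

lemma analyticOnNhd_clm_comp_left {X Y Z : Type*} [NormedAddCommGroup X] [NormedSpace ℂ X]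
    [NormedAddCommGroup Y] [NormedSpace ℂ Y] [NormedAddCommGroup Z] [NormedSpace ℂ Z]
    (S : Y →L[ℂ] Z) {F : ℂ → (X →L[ℂ] Y)} {U : Set ℂ} (hF : AnalyticOnNhd ℂ F U) :
    AnalyticOnNhd ℂ (fun lam => S ∘L F lam) U :=
  (ContinuousLinearMap.compL ℂ X Y Z S).comp_analyticOnNhd hF

/-- Gluing the resolvent in the upper half-plane and its continuation in a slit disc. -/
lemma exists_glued_continuation {c : Rn n → ℝ} (hc : IsWavespeed c) {χ : Rn n → ℂ}
    (hχ : IsCutoff χ) {δ : ℝ} {G : ℂ → (L2 n →L[ℂ] L2 n)}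
    (hG : AnalyticOnNhd ℂ G (Metric.ball 0 δ \ negImagAxis))
    (hGeq : ∀ lam : ℂ, 0 < lam.im → ‖lam‖ < δ →
      besselL2 n ∘L G lam = cutoffResolv c hc χ hχ lam) :
    ∃ F : ℂ → (L2 n →L[ℂ] L2 n),
      AnalyticOnNhd ℂ F ({lam : ℂ | 0 < lam.im} ∪ Metric.ball 0 δ \ negImagAxis) ∧
      (∀ lam : ℂ, 0 < lam.im → besselL2 n ∘L F lam = cutoffResolv c hc χ hχ lam) ∧
      ∀ lam ∈ Metric.ball (0 : ℂ) δ \ negImagAxis, F lam = G lam := by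
  classical
  set R : ℂ → (L2 n →L[ℂ] L2 n) := fun lam =>
    mulBessel hχ * Ring.inverse (shiftedBessel c hc lam) * mulOp χ hχ.bdd with hR
  have hRG : ∀ lam ∈ Metric.ball (0 : ℂ) δ \ negImagAxis, 0 < lam.im → R lam = G lam := by
    intro lam hlam h
    have h1 : besselL2 n ∘L R lam = besselL2 n ∘L G lam := by
      rw [hGeq lam h (by simpa using hlam.1), hR, besselL2_mulBessel_inverse hc hχ h]
    ext1 f
    have h2 : H2.incl n (bessel n (R lam f)) = H2.incl n (bessel n (G lam f)) := by
      rw [incl_bessel, incl_bessel]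
      exact congr($h1 f)
    exact (besselEquiv n).injective (incl_injective h2)
  have hFG : ∀ lam ∈ Metric.ball (0 : ℂ) δ \ negImagAxis,
      (if 0 < lam.im then R lam else G lam) = G lam := fun lam hlam => by
    split_ifs with h
    · exact hRG lam hlam h
    · rfl
  refine ⟨fun lam => if 0 < lam.im then R lam else G lam, ?_, fun lam h => ?_, hFG⟩
  · rintro lam (h | h)
    · have h1 : AnalyticAt ℂ R lam :=
        (analyticAt_const.mul (analyticAt_inverse_shiftedBessel hc h)).mul analyticAt_const
      refine h1.congr ?_
      filter_upwards [isOpen_upperHalfPlane.mem_nhds h] with z hz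
      exact (if_pos hz).symm
    · refine (hG lam h).congr ?_
      filter_upwards [(Metric.isOpen_ball.sdiff isClosed_negImagAxis).mem_nhds h] with z hz
      exact (hFG z hz).symm
  · simp only [if_pos h]
    exact besselL2_mulBessel_inverse hc hχ h

end LowEnergy

end

theorem proposition4p1 (n : ℕ) (hn : 2 ≤ n) (c : Rn n → ℝ) (hc : IsWavespeed c)
    (χ : Rn n → ℂ) (hχ : IsCutoff χ) :
    -- `R(lam) = (L - lam²)⁻¹` is well defined for `Im lam > 0`
    (∀ lam : ℂ, 0 < lam.im → (shiftedOp c hc lam).IsInvertible) ∧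
    ∃ ε₀ : ℝ, 0 < ε₀ ∧ ε₀ < 1 ∧
      -- `F` is the analytic continuation of `χ R(lam) χ : L² → H²`
      ∃ F : ℂ → (L2 n →L[ℂ] H2 n),
        AnalyticOnNhd ℂ F ({lam : ℂ | 0 < lam.im} ∪ slitSquare ε₀) ∧
        (∀ lam : ℂ, 0 < lam.im → H2.incl n ∘L F lam = cutoffResolv c hc χ hχ lam) ∧
        ∃ C : ℝ, 0 < C ∧ ∀ lam ∈ slitSquare ε₀,
          ‖H2.incl n ∘L F lam‖ ≤ C * (1 + ‖lam‖ ^ (n - 2) * ‖slitLog lam‖) := by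
  refine ⟨fun lam => shiftedOp_isInvertible hc, ?_⟩
  obtain ⟨δ, hδ0, hδ1, G, hG, hGeq, C, hC, hGb⟩ := exists_cutoffResolv_continuation hn hc hχ
  obtain ⟨F', hF', hFeq, hFb⟩ := exists_glued_continuation hc hχ hG hGeq
  have hincl : ∀ lam, H2.incl n ∘L (bessel n ∘L F' lam) = besselL2 n ∘L F' lam := fun lam => by
    rw [← ContinuousLinearMap.comp_assoc, incl_comp_bessel]
  refine ⟨δ / 3, by linarith, by linarith, fun lam => bessel n ∘L F' lam, ?_, fun lam h => ?_, C, hC,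
    fun lam h => ?_⟩
  · exact analyticOnNhd_clm_comp_left (bessel n)
      (hF'.mono (Set.union_subset_union_right _ fun lam => mem_ball_of_mem_slitSquare hδ0))
  · rw [hincl, hFeq lam h]
  · have h1 := mem_ball_of_mem_slitSquare hδ0 h
    rw [hincl, hFb lam h1]
    exact hGb lam h1
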